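/- Let $P$ be a set of pieces with a symmetric and reflexive (concurrency) relation $\mathcal C$, and let $k$ be a field. Heaps. A heap in $H(P,\mathcal C)$ is an isomorphism class of finite (possibly empty) posets $E$ with a labelling $\varepsilon:E\to P$ such that vertices with concurrent labels are comparable and $\le$ is the transitive closure of its restriction to pairs with concurrent labels. For $v\in E$, $E(v)$ is $E\setminus\{v\}$ with the transitive closure of the relation "$a\le b$ and $\varepsilon(a)\,\mathcal C\,\varepsilon(b)$". A heap is trivial if its order relation is equality. Property P1. Write $E(a)\prec E$ if $a$ is maximal (respectively, minimal) in $E$ and some $b$ with $\varepsilon(b)\ne\varepsilon(a)$ is maximal (respectively, minimal) in $E(a)$ but not in $E$. The heap $E$ has property P1 if there is a (possibly one-term) sequence $E_1\prec E_2\prec\cdots\prec E$ with $E_1$ trivial. Property P2. A convex chain of length $t$ is a chain $x_1<\cdots<x_t$ in $E$ containing every vertex that lies strictly between two of its members; it is balanced if $\varepsilon(x_1)=\varepsilon(x_t)$. The heap $E$ has property P2 if it contains no balanced convex chain of length $2$ or $3$. Acyclicity. An edge of $E$ is a pair $x<y$ with $\varepsilon(x)=\varepsilon(y)$ such that no $z$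 with $x<z<y$ has the same label. Let $\partial_E$ be the $k$-linear map from the $k$-span of the edges to the $k$-span of the vertices sending $(x,y)$ to the sum of all $w$ with $x<w<y$ and $\varepsilon(w)\,\mathcal C\,\varepsilon(x)$. The heap $E$ is acyclic if $\ker\partial_E=0$, and strongly acyclic if $E$ and all $E(v)$, $v\in E$, are acyclic. The algebra. Let $\mathrm{Co}(P,C)$ be the monoid generated by $P$ subject to $ab=ba$ whenever $a,b$ are not concurrent. Let $TL(P,\mathcal C)$ be the quotient of the monoid algebra of $\mathrm{Co}(P,C)$ over $\mathbb Z[v,v^{-1}]$ by the relations $ss=\delta s$, where $\delta=v+v^{-1}$, and $sts=s$ for $s\neq t$ with $s\,\mathcal C\,t$. The monomial in $\mathrm{Co}(P,C)$ of a heap is $\varepsilon(a_1)\cdots\varepsilon(a_r)$, where $a_1,\dots,a_r$ is any listing of its vertices compatible with the order; a heap is regarded as an element of $TL(P,\mathcal C)$ through its monomial. The monomial basis of $TL(P,\mathcal C)$ consists of the images of the monomials of the heaps with property P2, and "$p_1\cdots p_r$ is a monomial basis element" means that $p_1\cdots p_r$ is, in $\mathrm{Co}(P,C)$, the monomial of a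 heap with property P2. Theorem 1.5.1. The following are equivalent: (i) every heap in $H(P,\mathcal C)$ with property P2 has property P1 (i.e. $H(P,\mathcal C)$ is regular); (ii) every heap in $H(P,\mathcal C)$ with property P2 is strongly acyclic; (ii$'$) a heap in $H(P,\mathcal C)$ has property P2 if and only if it is strongly acyclic; (iii) if $E$ is a heap in $H(P,\mathcal C)$ with property P2 then, for every vertex $a$ of $E$, $E(a)$ is equal, as an element of $TL(P,\mathcal C)$, to a heap with property P2; (iii$'$) whenever $p_1p_2\cdots p_r$ is a monomial basis element of $TL(P,\mathcal C)$ and $1\le i\le r$, the monomial obtained by deleting $p_i$ is equal, as an element of $TL(P,\mathcal C)$, to a monomial basis element. -/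

import Mathlib

universe u v

/-- A symmetric and reflexive relation on the set `P` of pieces. -/
structure Concurrency (P : Type u) where
  rel : P → P → Prop
  refl : ∀ p, rel p p
  symm : ∀ p q, rel p q → rel q p

/-- A labelled heap with pieces in `P` and concurrency relation `C`: a finite (possibly empty)
poset with a labelling by pieces such that vertices with concurrent labels are comparable, and the
order is the transitive closure of its restriction to pairs with concurrent labels. A heap is a
labelled heap up to isomorphism; every notion below is invariant under isomorphism, so labelled
heaps are used as representatives. A finite poset has an isomorphic copy in `Type`. -/
structure LabelledHeap {P : Type u} (C : Concurrency P) where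
  carrier : Type
  finite : Finite carrier
  order : PartialOrder carrier
  label : carrier → P
  comparable : ∀ a b : carrier, C.rel (label a) (label b) → a ≤ b ∨ b ≤ a
  le_iff : ∀ a b : carrier,
    a ≤ b ↔ Relation.TransGen (fun x y => x ≤ y ∧ C.rel (label x) (label y)) a b

namespace LabelledHeap

variable {P : Type u} {C : Concurrency P}

instance (E : LabelledHeap C) : Finite E.carrier := E.finite

instance (E : LabelledHeap C) : PartialOrder E.carrier := E.order

noncomputable instance (E : LabelledHeap C) : Fintype E.carrier := Fintype.ofFinite _

/-- The relation on a set `F` of vertices whose transitive closure is the order of the subheap. -/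
def subRel (E : LabelledHeap C) (F : Set E.carrier) (a b : F) : Prop :=
  (a : E.carrier) ≤ b ∧ C.rel (E.label a) (E.label b)

theorem le_of_transGen_subRel (E : LabelledHeap C) (F : Set E.carrier) {a b : F}
    (h : Relation.TransGen (E.subRel F) a b) : (a : E.carrier) ≤ b := by
  induction h with
  | single h => exact h.1
  | tail _ h ih => exact ih.trans h.1

/-- The subheap of `E` on the set `F` of vertices. -/
def subheap (E : LabelledHeap C) (F : Set E.carrier) : LabelledHeap C where
  carrier := F
  finite := inferInstance
  order :=
    { le := Relation.TransGen (E.subRel F)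
      lt := fun a b => Relation.TransGen (E.subRel F) a b ∧ ¬ Relation.TransGen (E.subRel F) b a
      lt_iff_le_not_ge := fun _ _ => Iff.rfl
      le_refl := fun a => Relation.TransGen.single ⟨le_rfl, C.refl _⟩
      le_trans := fun _ _ _ h h' => h.trans h'
      le_antisymm := fun _ _ h h' =>
        Subtype.ext (le_antisymm (E.le_of_transGen_subRel F h) (E.le_of_transGen_subRel F h')) }
  label := fun a => E.label a
  comparable := fun a b h =>
    (E.comparable a b h).imp (fun h' => Relation.TransGen.single ⟨h', h⟩)
      (fun h' => Relation.TransGen.single ⟨h', C.symm _ _ h⟩)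
  le_iff := fun a b => by
    constructor
    · intro h
      induction h with
      | single h => exact Relation.TransGen.single ⟨Relation.TransGen.single h, h.2⟩
      | tail _ h ih => exact ih.tail ⟨Relation.TransGen.single h, h.2⟩
    · intro h
      induction h with
      | single h => exact h.1
      | tail _ h ih => exact Relation.TransGen.trans ih h.1

/-- `E(v)`: the subheap obtained by deleting the vertex `v`. -/
def delete (E : LabelledHeap C) (v : E.carrier) : LabelledHeap C :=
  E.subheap {x | x ≠ v}

/-- A trivial heap: the order relation is trivial. -/
def IsTrivial (E : LabelledHeap C) : Prop := ∀ a b : E.carrier, a ≤ b → a = b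

/-- `F ≺⁺ E`: `F = E(a)` for a maximal vertex `a`, and `E(a)` has a maximal vertex `b` that is not
maximal in `E` and whose label differs from that of `a`. -/
def PrecPlus (F E : LabelledHeap C) : Prop :=
  ∃ a : E.carrier, F = E.delete a ∧ IsMax a ∧
    ∃ b : (E.delete a).carrier, IsMax b ∧ ¬ IsMax (b.1 : E.carrier) ∧ E.label b.1 ≠ E.label a

/-- `F ≺⁻ E`: the same with minimal vertices. -/
def PrecMinus (F E : LabelledHeap C) : Prop :=
  ∃ a : E.carrier, F = E.delete a ∧ IsMin a ∧
    ∃ b : (E.delete a).carrier, IsMin b ∧ ¬ IsMin (b.1 : E.carrier) ∧ E.label b.1 ≠ E.label a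

/-- `F ≺ E`. -/
def Prec (F E : LabelledHeap C) : Prop := PrecPlus F E ∨ PrecMinus F E

/-- Property P1 (the heap is dismantlable): there is a possibly trivial sequence
`E₁ ≺ E₂ ≺ ⋯ ≺ E` with `E₁` a trivial heap. -/
def HasP1 (E : LabelledHeap C) : Prop :=
  ∃ E₁ : LabelledHeap C, E₁.IsTrivial ∧ Relation.ReflTransGen Prec E₁ E

/-- A convex chain `x₁ < x₂ < ⋯ < x_t`: every vertex strictly between two members is a member. -/
def IsConvexChain (E : LabelledHeap C) (c : List E.carrier) : Prop :=
  c ≠ [] ∧ c.Pairwise (· < ·) ∧ ∀ x ∈ c, ∀ z ∈ c, ∀ y, x < y → y < z → y ∈ c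

/-- A chain is balanced if its first and last vertices have the same label. -/
def IsBalanced (E : LabelledHeap C) (c : List E.carrier) : Prop :=
  ∃ h : c ≠ [], E.label (c.head h) = E.label (c.getLast h)

/-- Property P2: there are no balanced convex chains of length 2 or 3. -/
def HasP2 (E : LabelledHeap C) : Prop :=
  ∀ c : List E.carrier, E.IsConvexChain c → E.IsBalanced c → c.length ≠ 2 ∧ c.length ≠ 3

/-- The edges of `E`: pairs `x < y` with the same label `p` and no vertex labelled `p` strictly
between them. -/
def Edge (E : LabelledHeap C) : Type :=
  {e : E.carrier × E.carrier // e.1 < e.2 ∧ E.label e.1 = E.label e.2 ∧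
    ¬ ∃ z, E.label z = E.label e.1 ∧ e.1 < z ∧ z < e.2}

open Classical in
/-- The linear map `∂` from the span of the edges to the span of the vertices: it sends `(x, y)` to
the sum of the vertices `w` with `x < w < y` whose label is concurrent with that of `x`. -/
noncomputable def boundary (k : Type v) [Field k] (E : LabelledHeap C) :
    (E.Edge →₀ k) →ₗ[k] (E.carrier →₀ k) :=
  Finsupp.linearCombination k fun e : E.Edge =>
    ∑ w ∈ Finset.univ.filter
      (fun w => e.1.1 < w ∧ w < e.1.2 ∧ C.rel (E.label w) (E.label e.1.1)), Finsupp.single w (1 : k)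

/-- `E` is acyclic (over `k`) if `ker ∂ = 0`. -/
def IsAcyclic (k : Type v) [Field k] (E : LabelledHeap C) : Prop :=
  LinearMap.ker (E.boundary k) = ⊥

/-- `E` is strongly acyclic (over `k`) if `E` and all `E(v)` are acyclic. -/
def IsStronglyAcyclic (k : Type v) [Field k] (E : LabelledHeap C) : Prop :=
  E.IsAcyclic k ∧ ∀ v : E.carrier, (E.delete v).IsAcyclic k

end LabelledHeap

/-- The congruence on the free monoid generated by `ab ≡ ba` for `r a b`. -/
def commCon {A : Type u} (r : A → A → Prop) : Con (FreeMonoid A) :=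
  conGen fun x y => ∃ a b, r a b ∧
    x = FreeMonoid.of a * FreeMonoid.of b ∧ y = FreeMonoid.of b * FreeMonoid.of a

/-- The commutation monoid `Co(P, C)`, where two pieces commute if they are not concurrent. -/
abbrev Co {P : Type u} (C : Concurrency P) : Type u :=
  (commCon fun a b : P => ¬ C.rel a b).Quotient

namespace Co

variable {P : Type u} (C : Concurrency P)

/-- The generator of the commutation monoid given by a piece. -/
def gen (p : P) : Co C := ((FreeMonoid.of p : FreeMonoid P) : Co C)

/-- The monomial `p₁ p₂ ⋯ p_r`. -/
def word (w : List P) : Co C := (w.map (gen C)).prod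

theorem gen_commute {p q : P} (h : ¬ C.rel p q) : gen C p * gen C q = gen C q * gen C p :=
  (Con.eq _).2 (ConGen.Rel.of _ _ ⟨p, q, h, rfl, rfl⟩)

end Co

namespace LabelledHeap

variable {P : Type u} {C : Concurrency P}

/-- The list `l` contains each vertex exactly once, in an order compatible with that of `E`;
that is, `E = a₁ ∘ a₂ ∘ ⋯ ∘ a_r` for `l = [a₁, …, a_r]`. -/
def IsLinearization (E : LabelledHeap C) (l : List E.carrier) : Prop :=
  l.Nodup ∧ (∀ a, a ∈ l) ∧ l.Pairwise fun a b => ¬ b < a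

theorem exists_linearization (E : LabelledHeap C) : ∃ l, E.IsLinearization l := by
  let f : E.carrier →o LinearExtension E.carrier := toLinearExtension
  let r : E.carrier → E.carrier → Prop := fun a b => f a ≤ f b
  have hinj : Function.Injective f := fun _ _ h => h
  obtain ⟨l₀, hl₀⟩ : ∃ l₀ : List E.carrier, l₀.Nodup ∧ ∀ a, a ∈ l₀ :=
    ⟨Finset.univ.toList, Finset.nodup_toList _, fun a => by simp⟩
  classical
  let l := l₀.mergeSort fun a b => decide (f a ≤ f b)
  have hp : l.Perm l₀ := List.mergeSort_perm _ _
  have h1 : l.Nodup := hp.nodup_iff.2 hl₀.1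
  have h3 : l.Pairwise fun a b => decide (f a ≤ f b) = true := by
    refine List.pairwise_mergeSort (fun a b c h h' => ?_) (fun a b => ?_) l₀
    · simp only [decide_eq_true_eq] at h h' ⊢
      exact h.trans h'
    · simpa using le_total (f a) (f b)
  refine ⟨l, h1, fun a => hp.symm.subset (hl₀.2 a), ?_⟩
  refine (h3.and h1).imp ?_
  rintro a b ⟨hab, hne⟩ hba
  exact hne (hinj (le_antisymm (of_decide_eq_true hab) (f.monotone hba.le)))

/-- The monomial of a heap: `a₁ ∘ a₂ ∘ ⋯ ∘ a_r` is sent to `ε(a₁) ε(a₂) ⋯ ε(a_r)`. -/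
noncomputable def monomial (E : LabelledHeap C) : Co C :=
  Co.word C (E.exists_linearization.choose.map E.label)

theorem word_eq_of_perm (E : LabelledHeap C) (l₁ : List E.carrier) :
    ∀ l₂ : List E.carrier, l₁.Perm l₂ → l₁.Nodup → l₁.Pairwise (fun a b => ¬ b < a) →
      l₂.Pairwise (fun a b => ¬ b < a) →
      Co.word C (l₁.map E.label) = Co.word C (l₂.map E.label) := by
  induction l₁ with
  | nil => intro l₂ h _ _ _; rw [List.nil_perm.1 h]
  | cons a t ih =>
    intro l₂ hp hn h₁ h₂
    obtain ⟨s, r, rfl⟩ := List.append_of_mem (hp.subset List.mem_cons_self)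
    have hp' : t.Perm (s ++ r) := (List.perm_cons a).1 (hp.trans List.perm_middle)
    have hn' := List.nodup_cons.1 hn
    have h₁' := List.pairwise_cons.1 h₁
    have h₂' := List.pairwise_append.1 h₂
    have hs : ∀ x ∈ s, Commute (Co.gen C (E.label a)) (Co.gen C (E.label x)) := by
      intro x hx
      have hxt : x ∈ t := hp'.symm.subset (List.mem_append_left _ hx)
      have hxa : x ≠ a := fun h => hn'.1 (h ▸ hxt)
      refine Co.gen_commute C fun hC => ?_
      rcases E.comparable a x hC with h | h
      · exact h₂'.2.2 x hx a List.mem_cons_self (lt_of_le_of_ne h hxa.symm)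
      · exact h₁'.1 x hxt (lt_of_le_of_ne h hxa)
    have hc : Commute (Co.gen C (E.label a)) (Co.word C (s.map E.label)) := by
      refine Commute.list_prod_right _ _ fun y hy => ?_
      simp only [List.map_map, List.mem_map] at hy
      obtain ⟨x, hx, rfl⟩ := hy
      exact hs x hx
    have hsub : (s ++ r).Sublist (s ++ a :: r) :=
      (List.Sublist.refl s).append (List.sublist_cons_self a r)
    have key := ih (s ++ r) hp' hn'.2 h₁'.2 (h₂.sublist hsub)
    simp only [Co.word, List.map_append, List.map_cons, List.prod_append, List.prod_cons]
      at key hc ⊢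
    rw [key, ← mul_assoc, hc.eq, mul_assoc]

/-- The monomial does not depend on the chosen decomposition `E = a₁ ∘ a₂ ∘ ⋯ ∘ a_r`. -/
theorem monomial_eq (E : LabelledHeap C) {l : List E.carrier} (h : E.IsLinearization l) :
    E.monomial = Co.word C (l.map E.label) := by
  have h' := E.exists_linearization.choose_spec
  refine E.word_eq_of_perm _ _ ?_ h'.1 h'.2.2 h.2.2
  exact (List.perm_ext_iff_of_nodup h'.1 h.1).2 fun a => ⟨fun _ => h.2.1 a, fun _ => h'.2.1 a⟩

end LabelledHeap

/-- The defining relations `s s = δ s`, with `δ = v + v⁻¹` in `ℤ[v, v⁻¹]`, and `s t s = s` for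
`s ≠ t` concurrent. -/
inductive TLRel {P : Type u} (C : Concurrency P) :
    MonoidAlgebra (LaurentPolynomial ℤ) (Co C) → MonoidAlgebra (LaurentPolynomial ℤ) (Co C) → Prop
  | sq (s : P) : TLRel C
      (MonoidAlgebra.of (LaurentPolynomial ℤ) (Co C) (Co.gen C s * Co.gen C s))
      ((LaurentPolynomial.T 1 + LaurentPolynomial.T (-1) : LaurentPolynomial ℤ) •
        MonoidAlgebra.of (LaurentPolynomial ℤ) (Co C) (Co.gen C s))
  | braid (s t : P) : s ≠ t → C.rel s t → TLRel C
      (MonoidAlgebra.of (LaurentPolynomial ℤ) (Co C) (Co.gen C s * Co.gen C t * Co.gen C s))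
      (MonoidAlgebra.of (LaurentPolynomial ℤ) (Co C) (Co.gen C s))

/-- The generalized Temperley–Lieb algebra, as an algebra over `ℤ[v, v⁻¹]`. -/
abbrev TL {P : Type u} (C : Concurrency P) : Type u := RingQuot (TLRel C)

namespace TL

variable {P : Type u} (C : Concurrency P)

/-- The image in the Temperley–Lieb algebra of an element of the commutation monoid. -/
noncomputable def ofCo (m : Co C) : TL C :=
  RingQuot.mkAlgHom (LaurentPolynomial ℤ) (TLRel C) (MonoidAlgebra.of _ _ m)

/-- The monomials that index the monomial basis: those of the heaps with property P2. -/
def IsBasisMonomial (m : Co C) : Prop :=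
  ∃ E : LabelledHeap C, E.HasP2 ∧ E.monomial = m

/-- The monomial basis of the Temperley–Lieb algebra. -/
def monomialBasis : Set (TL C) := {x | ∃ m : Co C, IsBasisMonomial C m ∧ ofCo C m = x}

end TL

/-- A heap as an element of the Temperley–Lieb algebra. -/
noncomputable def LabelledHeap.toTL {P : Type u} {C : Concurrency P} (E : LabelledHeap C) : TL C :=
  TL.ofCo C E.monomial

/-! ### Words, monomials and rearrangement of listings. -/

namespace Co

variable {P : Type u} {C : Concurrency P}

/-! Everything is carried over to the commutation monoid. Property P2 says that the monomial of the
heap has no factor `s s` and no factor `s t s` with `s ≠ t` concurrent (`hasP2_iff`). Call such a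
monomial irreducible, and call a monomial reducible if replacements of `s t s` by `s` lead from it
to an irreducible one.

No replacement can remove the last square, so reducible monomials contain none
(`not_reducible_of_sq`). Two overlapping factors `s t s` either form `s t s t`, where both
replacements give `s t`, or share only their middle letter, where replacing one leaves a square.
Hence every replacement in a reducible monomial leaves a reducible one (`reducible_braid_iff`). The
functional with value 1 on reducible monomials and 0 on the others therefore respects the relations
once `δ` is specialized to 0, so a monomial equals a monomial basis element in the algebra exactly
when it is reducible (`ofCo_mem_monomialBasis_iff`). Conditions (iii) and (iii') both become:
deleting a letter of an irreducible monomial leaves a reducible one.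

Condition (i) amounts to: every heap with P2 is trivial, or the removal of some extremal vertex
exposes another (`forall_hasP1_iff`). Given this, deletions are handled by induction on the length,
peeling off the removed vertex (`IsIrr.deletesReducibly`). Conversely, take a minimal heap with P2
that is not trivial and admits no such removal. Glue it to its mirror image along its maximal
vertices; the result is irreducible. Delete one letter of the fold and contract factors `b a b` at
the fold. Each contraction trades one maximal vertex of the half for another, until only the minimal
vertices are left. So there is one more maximal vertex than there are minimal ones; the opposite
heap gives the reverse, which is absurd (`starReducible_of_deletesReducibly`).

For acyclicity, an edge `(x, y)` is read as the vertex vector `x - y`. A factor `s s` gives a kernel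
vector, and contracting `s t s` preserves acyclicity in both directions, so acyclic heaps have
reducible monomials (`AcyclicOn.reducible`). Under (i) the converse holds
(`acyclicOn_of_reducible`), since restoring a removed extremal vertex that had exposed another
preserves acyclicity. Deleting the middle of `s t s` creates a square, so strongly acyclic heaps
always have P2. -/

@[simp] theorem word_nil : word C [] = 1 := rfl

@[simp] theorem word_cons (p : P) (w : List P) : word C (p :: w) = gen C p * word C w := by
  simp [word]

@[simp] theorem word_append (w w' : List P) : word C (w ++ w') = word C w * word C w' := by
  simp [word]

theorem word_eq_coe (w : List P) : word C w = ((FreeMonoid.ofList w : FreeMonoid P) : Co C) := by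
  induction w with
  | nil => rfl
  | cons p w ih => rw [word_cons, ih]; rfl

theorem exists_word (m : Co C) : ∃ w, word C w = m := by
  induction m using Con.induction_on with
  | H w => exact ⟨FreeMonoid.toList w, word_eq_coe _⟩

theorem gen_commute_word {p : P} {w : List P} (h : ∀ q ∈ w, ¬ C.rel p q) :
    gen C p * word C w = word C w * gen C p := by
  induction w with
  | nil => simp
  | cons q w ih =>
    rw [word_cons, ← mul_assoc, gen_commute C (h q List.mem_cons_self), mul_assoc,
      ih fun r hr => h r (List.mem_cons_of_mem _ hr), mul_assoc]

/-- Every listing of labelled vertices spelling `w` can be rearranged to one spelling `w'`, keeping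
the listing compatible with `R`. -/
def Rearranges {V : Type*} (label : V → P) (R : V → V → Prop) (w w' : List P) : Prop :=
  ∀ l : List V, l.map label = w → ∃ l', l'.map label = w' ∧ l.Perm l' ∧
    (l.Pairwise (fun a b => ¬ R b a) → l'.Pairwise fun a b => ¬ R b a)

theorem Rearranges.append {V : Type*} {label : V → P} {R : V → V → Prop} {w₁ w₂ w₁' w₂' : List P}
    (h₁ : Rearranges label R w₁ w₁') (h₂ : Rearranges label R w₂ w₂') :
    Rearranges label R (w₁ ++ w₂) (w₁' ++ w₂') := by
  intro l hl
  obtain ⟨l₁, l₂, rfl, e₁, e₂⟩ := List.map_eq_append_iff.1 hl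
  obtain ⟨l₁', f₁, p₁, q₁⟩ := h₁ l₁ e₁
  obtain ⟨l₂', f₂, p₂, q₂⟩ := h₂ l₂ e₂
  refine ⟨l₁' ++ l₂', by simp [f₁, f₂], p₁.append p₂, fun h => ?_⟩
  obtain ⟨a, b, c⟩ := List.pairwise_append.1 h
  exact List.pairwise_append.2
    ⟨q₁ a, q₂ b, fun x hx y hy => c x (p₁.symm.subset hx) y (p₂.symm.subset hy)⟩

theorem rearranges_swap {V : Type*} {label : V → P} {R : V → V → Prop}
    (hR : ∀ a b, R a b → C.rel (label a) (label b)) {p q : P} (h : ¬ C.rel p q) :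
    Rearranges label R [p, q] [q, p] := by
  intro l hl
  obtain ⟨a, l₁, rfl, rfl, h₁⟩ := List.map_eq_cons_iff.1 hl
  obtain ⟨b, l₂, rfl, rfl, h₂⟩ := List.map_eq_cons_iff.1 h₁
  obtain rfl := List.map_eq_nil_iff.1 h₂
  refine ⟨[b, a], rfl, List.Perm.swap _ _ _, fun _ => ?_⟩
  simpa using fun h' => h (hR _ _ h')

/-- Each generating swap exchanges letters that are not concurrent, hence vertices unrelated by `R`.
Both directions are proved together because the generated congruence is closed under symmetry. -/
theorem rearranges_of_conGen {V : Type*} {label : V → P} {R : V → V → Prop}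
    (hR : ∀ a b, R a b → C.rel (label a) (label b)) {w w' : FreeMonoid P}
    (h : ConGen.Rel (fun x y => ∃ a b, ¬ C.rel a b ∧
      x = FreeMonoid.of a * FreeMonoid.of b ∧ y = FreeMonoid.of b * FreeMonoid.of a) w w') :
    Rearranges label R (FreeMonoid.toList w) (FreeMonoid.toList w') ∧
      Rearranges label R (FreeMonoid.toList w') (FreeMonoid.toList w) := by
  induction h with
  | of x y h =>
    obtain ⟨a, b, h, rfl, rfl⟩ := h
    exact ⟨rearranges_swap hR h, rearranges_swap hR fun h' => h (C.symm _ _ h')⟩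
  | refl x => exact ⟨fun l hl => ⟨l, hl, .refl _, id⟩, fun l hl => ⟨l, hl, .refl _, id⟩⟩
  | symm _ ih => exact ⟨ih.2, ih.1⟩
  | trans _ _ ih₁ ih₂ =>
    constructor
    · intro l hl
      obtain ⟨l₁, e₁, p₁, q₁⟩ := ih₁.1 l hl
      obtain ⟨l₂, e₂, p₂, q₂⟩ := ih₂.1 l₁ e₁
      exact ⟨l₂, e₂, p₁.trans p₂, q₂ ∘ q₁⟩
    · intro l hl
      obtain ⟨l₁, e₁, p₁, q₁⟩ := ih₂.2 l hl
      obtain ⟨l₂, e₂, p₂, q₂⟩ := ih₁.2 l₁ e₁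
      exact ⟨l₂, e₂, p₁.trans p₂, q₂ ∘ q₁⟩
  | mul _ _ ih₁ ih₂ => exact ⟨ih₁.1.append ih₂.1, ih₁.2.append ih₂.2⟩

theorem rearranges_of_word_eq {V : Type*} {label : V → P} {R : V → V → Prop}
    (hR : ∀ a b, R a b → C.rel (label a) (label b)) {w w' : List P}
    (h : word C w = word C w') : Rearranges label R w w' := by
  rw [word_eq_coe, word_eq_coe] at h
  exact (rearranges_of_conGen hR ((Con.eq _).1 h)).1

/-- Two compatible listings of the same vertices spell the same monomial. -/
theorem word_eq_of_perm {V : Type*} {label : V → P} {R : V → V → Prop}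
    (hR : ∀ a b, a ≠ b → C.rel (label a) (label b) → R a b ∨ R b a) (l₁ : List V) :
    ∀ l₂ : List V, l₁.Perm l₂ → l₁.Nodup → l₁.Pairwise (fun a b => ¬ R b a) →
      l₂.Pairwise (fun a b => ¬ R b a) → word C (l₁.map label) = word C (l₂.map label) := by
  induction l₁ with
  | nil => intro l₂ h _ _ _; rw [List.nil_perm.1 h]
  | cons a t ih =>
    intro l₂ hp hn h₁ h₂
    obtain ⟨s, r, rfl⟩ := List.append_of_mem (hp.subset List.mem_cons_self)
    have hp' : t.Perm (s ++ r) := (List.perm_cons a).1 (hp.trans List.perm_middle)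
    have hn' := List.nodup_cons.1 hn
    have h₁' := List.pairwise_cons.1 h₁
    have h₂' := List.pairwise_append.1 h₂
    have hc : gen C (label a) * word C (s.map label) = word C (s.map label) * gen C (label a) := by
      refine gen_commute_word fun q hq hC => ?_
      obtain ⟨x, hx, rfl⟩ := List.mem_map.1 hq
      have hxt : x ∈ t := hp'.symm.subset (List.mem_append_left _ hx)
      rcases hR a x (fun h => hn'.1 (h ▸ hxt)) hC with h | h
      · exact h₂'.2.2 x hx a List.mem_cons_self h
      · exact h₁'.1 x hxt h
    have hsub : (s ++ r).Sublist (s ++ a :: r) :=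
      (List.Sublist.refl s).append (List.sublist_cons_self a r)
    have key := ih (s ++ r) hp' hn'.2 h₁'.2 (h₂.sublist hsub)
    simp only [List.map_append, List.map_cons, word_append, word_cons] at key ⊢
    rw [key, ← mul_assoc, hc, mul_assoc]

/-- The length of a monomial. -/
def length : Co C →* Multiplicative ℕ :=
  Con.lift _ (FreeMonoid.lift fun _ => Multiplicative.ofAdd 1) <| Con.conGen_le.2 <| by
    rintro _ _ ⟨a, b, _, rfl, rfl⟩
    rfl

/-- The length of a monomial, as a natural number. -/
def len (m : Co C) : ℕ := (length m).toAdd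

@[simp] theorem len_mul (m n : Co C) : (m * n).len = m.len + n.len := by simp [len]

@[simp] theorem len_gen (p : P) : (gen C p).len = 1 := rfl

@[simp] theorem len_one : (1 : Co C).len = 0 := rfl

/-- Reversal of monomials. -/
def revHom : Co C →* (Co C)ᵐᵒᵖ :=
  Con.lift _ (FreeMonoid.lift fun p => MulOpposite.op (gen C p)) <| Con.conGen_le.2 <| by
    rintro _ _ ⟨a, b, h, rfl, rfl⟩
    simp only [Con.ker_rel, map_mul, FreeMonoid.lift_eval_of, ← MulOpposite.op_mul]
    rw [gen_commute C h]

/-- The reversal of a monomial. -/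
def rev (m : Co C) : Co C := (revHom m).unop

@[simp] theorem rev_mul (m n : Co C) : (m * n).rev = n.rev * m.rev := by simp [rev]

@[simp] theorem rev_one : (1 : Co C).rev = 1 := by simp [rev]

@[simp] theorem rev_gen (p : P) : (gen C p).rev = gen C p := rfl

@[simp] theorem rev_word (w : List P) : (word C w).rev = word C w.reverse := by
  induction w with
  | nil => simp
  | cons p w ih => simp [ih]

@[simp] theorem rev_rev (m : Co C) : m.rev.rev = m := by
  obtain ⟨w, rfl⟩ := exists_word m
  simp

@[simp] theorem len_rev (m : Co C) : m.rev.len = m.len := by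
  obtain ⟨w, rfl⟩ := exists_word m
  induction w with
  | nil => simp
  | cons p w ih => simpa [add_comm] using ih

end Co

/-! ### Dictionary between sets of vertices of a heap and monomials. -/

namespace LabelledHeap

variable {P : Type u} {C : Concurrency P} (E : LabelledHeap C)

/-- `x < y` with concurrent labels. -/
def R (x y : E.carrier) : Prop := x < y ∧ C.rel (E.label x) (E.label y)

variable {E}

theorem R.lt {x y : E.carrier} (h : E.R x y) : x < y := h.1

theorem R.ne {x y : E.carrier} (h : E.R x y) : x ≠ y := h.1.ne

theorem R.rel {x y : E.carrier} (h : E.R x y) : C.rel (E.label x) (E.label y) := h.2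

theorem R.asymm {x y : E.carrier} (h : E.R x y) : ¬ E.R y x := fun h' => h.1.asymm h'.1

theorem R_irrefl (x : E.carrier) : ¬ E.R x x := fun h => h.1.false

theorem R_total {x y : E.carrier} (hne : x ≠ y) (h : C.rel (E.label x) (E.label y)) :
    E.R x y ∨ E.R y x :=
  (E.comparable x y h).imp (fun h' => ⟨lt_of_le_of_ne h' hne, h⟩)
    fun h' => ⟨lt_of_le_of_ne h' hne.symm, C.symm _ _ h⟩

theorem R_of_lt_of_eq {x y : E.carrier} (h : x < y) (hl : E.label x = E.label y) : E.R x y :=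
  ⟨h, hl ▸ C.refl _⟩

/-- Concurrency is not transitive, so `R` is not either. A coincidence among the three labels
supplies the concurrency of the outer two. -/
theorem R.trans_of_eq {x y z : E.carrier} (h : E.R x y) (h' : E.R y z)
    (hl : E.label x = E.label y ∨ E.label y = E.label z ∨ E.label x = E.label z) : E.R x z := by
  refine ⟨h.1.trans h'.1, ?_⟩
  rcases hl with hl | hl | hl
  · rw [hl]; exact h'.2
  · rw [← hl]; exact h.2
  · rw [hl]; exact C.refl _

/-- The order is generated by concurrent comparable pairs, so a strict inequality has a first proper
step with concurrent labels. -/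
theorem exists_R_le_of_lt {x y : E.carrier} (h : x < y) : ∃ u, E.R x u ∧ u ≤ y := by
  have h' := (E.le_iff x y).1 h.le
  have key : x = y ∨ ∃ u, E.R x u ∧ u ≤ y := by
    clear h
    induction h' with
    | @single b h =>
      by_cases hb : x = b
      · exact .inl hb
      · exact .inr ⟨b, ⟨lt_of_le_of_ne h.1 hb, h.2⟩, le_rfl⟩
    | @tail b c _ h ih =>
      rcases ih with rfl | ⟨u, hu, hub⟩
      · by_cases hb : x = c
        · exact .inl hb
        · exact .inr ⟨c, ⟨lt_of_le_of_ne h.1 hb, h.2⟩, le_rfl⟩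
      · exact .inr ⟨u, hu, hub.trans h.1⟩
  exact key.resolve_left h.ne

theorem exists_le_R_of_lt {x y : E.carrier} (h : x < y) : ∃ u, x ≤ u ∧ E.R u y := by
  have h' := (E.le_iff x y).1 h.le
  have key : x = y ∨ ∃ u, x ≤ u ∧ E.R u y := by
    clear h
    induction h' with
    | @single b h =>
      by_cases hb : x = b
      · exact .inl hb
      · exact .inr ⟨x, le_rfl, lt_of_le_of_ne h.1 hb, h.2⟩
    | @tail b c hxb h ih =>
      by_cases hb : b = c
      · exact hb ▸ ih
      · exact .inr ⟨b, (E.le_iff x b).2 hxb, lt_of_le_of_ne h.1 hb, h.2⟩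
  exact key.resolve_left h.ne

/-- The order of a subheap is regenerated from its concurrent pairs, so it is `R`, and not `<`, that
restricts to subsets. This is why the arguments below are phrased with `R`. -/
theorem subheap_R {S : Set E.carrier} (a b : S) : (E.subheap S).R a b ↔ E.R a.1 b.1 := by
  constructor
  · rintro ⟨h, h'⟩
    refine ⟨lt_of_le_of_ne (E.le_of_transGen_subRel S h.le) fun e => ?_, h'⟩
    exact h.ne (Subtype.ext e)
  · rintro ⟨h, h'⟩
    refine ⟨lt_of_le_of_ne (Relation.TransGen.single ⟨h.le, h'⟩ : (E.subheap S).order.le a b) ?_, h'⟩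
    rintro rfl
    exact h.false

variable (E)

/-- The list `l` lists the vertices in `S` in an order compatible with that of the subheap. -/
structure IsListing (S : Set E.carrier) (l : List E.carrier) : Prop where
  nodup : l.Nodup
  mem : ∀ x, x ∈ l ↔ x ∈ S
  pairwise : l.Pairwise fun a b => ¬ E.R b a

theorem exists_isListing (S : Set E.carrier) : ∃ l, E.IsListing S l := by
  classical
  obtain ⟨l, h₁, h₂, h₃⟩ := E.exists_linearization
  exact ⟨l.filter (· ∈ S), h₁.filter _, fun x => by simp [h₂],
    (h₃.filter _).imp fun h h' => h h'.1⟩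

/-- The monomial of the subheap on `S`. -/
noncomputable def mon (S : Set E.carrier) : Co C :=
  Co.word C ((E.exists_isListing S).choose.map E.label)

variable {E} {S : Set E.carrier} {l : List E.carrier}

theorem IsListing.mon_eq (h : E.IsListing S l) : E.mon S = Co.word C (l.map E.label) := by
  have h' := (E.exists_isListing S).choose_spec
  refine Co.word_eq_of_perm (R := E.R) (fun _ _ => R_total) _ _ ?_ h'.nodup h'.pairwise h.pairwise
  exact (List.perm_ext_iff_of_nodup h'.nodup h.nodup).2 fun a => (h'.mem a).trans (h.mem a).symm

variable (E) in
theorem mon_univ : E.mon Set.univ = E.monomial := by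
  obtain ⟨l, hl⟩ := E.exists_linearization
  rw [monomial_eq E hl]
  exact IsListing.mon_eq ⟨hl.1, fun x => by simp [hl.2.1], hl.2.2.imp fun h h' => h h'.1⟩

variable (E) in
theorem subheap_mon (S : Set E.carrier) (T : Set S) :
    (E.subheap S).mon T = E.mon (Subtype.val '' T) := by
  obtain ⟨l, hl⟩ : ∃ l : List S, (E.subheap S).IsListing T l :=
    exists_isListing (E.subheap S) T
  have h : E.IsListing (Subtype.val '' T) (l.map Subtype.val) := by
    refine ⟨hl.nodup.map Subtype.val_injective, fun x => ?_, ?_⟩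
    · rw [List.mem_map, Set.mem_image]
      exact exists_congr fun a => and_congr_left fun _ => hl.mem a
    · exact List.pairwise_map.2 (hl.pairwise.imp fun h h' => h ((subheap_R _ _).2 h'))
  rw [hl.mon_eq, h.mon_eq]
  exact congrArg (Co.word C) (List.map_map (f := Subtype.val) (g := E.label)).symm

variable (E) in
-- Allows iterated deletions to be treated as subsets of one carrier instead of nested subtypes.
theorem subheap_monomial (S : Set E.carrier) : (E.subheap S).monomial = E.mon S := by
  rw [← mon_univ]
  refine (subheap_mon E S Set.univ).trans ?_
  simp

/-- Every spelling of the monomial comes from a compatible listing of the same vertices, since the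
swaps of letters lift to swaps of vertices. Factorizations of monomials thus turn into positions of
vertices. -/
theorem exists_isListing_of_mon_eq {w : List P} (h : E.mon S = Co.word C w) :
    ∃ l, E.IsListing S l ∧ l.map E.label = w := by
  obtain ⟨l, hl⟩ := E.exists_isListing S
  obtain ⟨l', h₁, h₂, h₃⟩ := Co.rearranges_of_word_eq (R := E.R) (fun _ _ h => h.rel)
    (hl.mon_eq.symm.trans h) l rfl
  exact ⟨l', ⟨h₂.nodup_iff.1 hl.nodup, fun x => h₂.mem_iff.symm.trans (hl.mem x),
    h₃ hl.pairwise⟩, h₁⟩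

theorem IsListing.pairwise_R (h : E.IsListing S l) :
    l.Pairwise fun a b => C.rel (E.label a) (E.label b) → E.R a b :=
  (h.nodup.imp₂ (fun _ _ hne hR hC => (R_total hne hC).resolve_right hR) h.pairwise)

theorem IsListing.erase {l₁ l₂ : List E.carrier} {v : E.carrier}
    (h : E.IsListing S (l₁ ++ v :: l₂)) : E.IsListing (S \ {v}) (l₁ ++ l₂) := by
  have hs : (l₁ ++ l₂).Sublist (l₁ ++ v :: l₂) :=
    (List.Sublist.refl l₁).append (List.sublist_cons_self v l₂)
  refine ⟨h.nodup.sublist hs, fun x => ?_, h.pairwise.sublist hs⟩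
  have hn := (List.nodup_middle.1 h.nodup)
  rw [List.nodup_cons] at hn
  have hm := h.mem x
  simp only [List.mem_append, List.mem_cons, Set.mem_sdiff, Set.mem_singleton_iff] at hm hn ⊢
  constructor
  · intro hx
    refine ⟨hm.1 (hx.imp id .inr), ?_⟩
    rintro rfl
    exact hn.1 hx
  · rintro ⟨hx, hne⟩
    have := hm.2 hx
    tauto

theorem IsListing.mem_of_R {l₁ l₂ : List E.carrier} {x y : E.carrier}
    (h : E.IsListing S (l₁ ++ x :: l₂)) (hy : y ∈ S) (hR : E.R x y) : y ∈ l₂ := by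
  have hm := (h.mem y).2 hy
  simp only [List.mem_append, List.mem_cons] at hm
  rcases hm with hm | rfl | hm
  · exact absurd hR ((List.pairwise_append.1 h.pairwise).2.2 y hm x List.mem_cons_self)
  · exact absurd hR (R_irrefl _)
  · exact hm

theorem IsListing.R_right {l₁ l₂ : List E.carrier} {x y : E.carrier}
    (h : E.IsListing S (l₁ ++ x :: l₂)) (hy : y ∈ l₂) (hC : C.rel (E.label x) (E.label y)) :
    E.R x y :=
  List.rel_of_pairwise_cons (List.pairwise_append.1 h.pairwise_R).2.1 hy hC

theorem IsListing.R_left {l₁ l₂ : List E.carrier} {x y : E.carrier}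
    (h : E.IsListing S (l₁ ++ x :: l₂)) (hy : y ∈ l₁) (hC : C.rel (E.label y) (E.label x)) :
    E.R y x :=
  (List.pairwise_append.1 h.pairwise_R).2.2 y hy x List.mem_cons_self hC

theorem exists_isListing_append {x : E.carrier} (hx : x ∈ S) :
    ∃ l₁ l₂, E.IsListing S (l₁ ++ x :: l₂) := by
  obtain ⟨l, hl⟩ := E.exists_isListing S
  obtain ⟨l₁, l₂, rfl⟩ := List.append_of_mem ((hl.mem x).2 hx)
  exact ⟨l₁, l₂, hl⟩

theorem exists_mon_eq_of_mem {x : E.carrier} (hx : x ∈ S) :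
    ∃ X Y, E.mon S = X * Co.gen C (E.label x) * Y ∧ E.mon (S \ {x}) = X * Y := by
  obtain ⟨l₁, l₂, hl⟩ := exists_isListing_append hx
  exact ⟨Co.word C (l₁.map E.label), Co.word C (l₂.map E.label),
    by simp [hl.mon_eq, mul_assoc], by simp [hl.erase.mon_eq]⟩

theorem exists_mem_of_mon_eq {X Y : Co C} {p : P} (h : E.mon S = X * Co.gen C p * Y) :
    ∃ x ∈ S, E.label x = p ∧ E.mon (S \ {x}) = X * Y := by
  obtain ⟨w, rfl⟩ := Co.exists_word X
  obtain ⟨w', rfl⟩ := Co.exists_word Y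
  obtain ⟨l, hl, e⟩ := exists_isListing_of_mon_eq (E := E) (S := S) (w := w ++ p :: w') (by simp [h, mul_assoc])
  obtain ⟨l₁, l', rfl, rfl, e1⟩ := List.map_eq_append_iff.1 e
  obtain ⟨x, l₂, rfl, rfl, rfl⟩ := List.map_eq_cons_iff.1 e1
  exact ⟨x, (hl.mem x).1 (by simp), rfl, by simp [hl.erase.mon_eq]⟩

variable (E) in
/-- `x` is a maximal vertex of the subheap on `S`. -/
def MaxIn (S : Set E.carrier) (x : E.carrier) : Prop := x ∈ S ∧ ∀ y ∈ S, ¬ E.R x y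

variable (E) in
/-- `x` is a minimal vertex of the subheap on `S`. -/
def MinIn (S : Set E.carrier) (x : E.carrier) : Prop := x ∈ S ∧ ∀ y ∈ S, ¬ E.R y x

theorem MaxIn.mon_eq {x : E.carrier} (h : E.MaxIn S x) :
    E.mon S = E.mon (S \ {x}) * Co.gen C (E.label x) := by
  obtain ⟨l₁, l₂, hl⟩ := exists_isListing_append h.1
  have hc : Co.gen C (E.label x) * Co.word C (l₂.map E.label) =
      Co.word C (l₂.map E.label) * Co.gen C (E.label x) := by
    refine Co.gen_commute_word fun q hq hC => ?_
    obtain ⟨y, hy, rfl⟩ := List.mem_map.1 hq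
    exact h.2 y ((hl.mem y).1 (by simp [hy])) (hl.R_right hy hC)
  simp [hl.mon_eq, hl.erase.mon_eq, hc, mul_assoc]

theorem MinIn.mon_eq {x : E.carrier} (h : E.MinIn S x) :
    E.mon S = Co.gen C (E.label x) * E.mon (S \ {x}) := by
  obtain ⟨l₁, l₂, hl⟩ := exists_isListing_append h.1
  have hc : Co.gen C (E.label x) * Co.word C (l₁.map E.label) =
      Co.word C (l₁.map E.label) * Co.gen C (E.label x) := by
    refine Co.gen_commute_word fun q hq hC => ?_
    obtain ⟨y, hy, rfl⟩ := List.mem_map.1 hq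
    exact h.2 y ((hl.mem y).1 (by simp [hy])) (hl.R_left hy (C.symm _ _ hC))
  rw [hl.mon_eq, hl.erase.mon_eq]
  simp only [List.map_append, List.map_cons, Co.word_append, Co.word_cons]
  rw [← mul_assoc, ← hc, mul_assoc]

theorem IsListing.maxIn {x : E.carrier} (h : E.IsListing S (l ++ [x])) : E.MaxIn S x :=
  ⟨(h.mem x).1 (by simp), fun y hy hR => by simpa using h.mem_of_R hy hR⟩

theorem exists_maxIn_of_mon_eq {Z : Co C} {s : P} (h : E.mon S = Z * Co.gen C s) :
    ∃ x, E.MaxIn S x ∧ E.label x = s ∧ E.mon (S \ {x}) = Z := by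
  obtain ⟨w, rfl⟩ := Co.exists_word Z
  obtain ⟨l, hl, e⟩ := exists_isListing_of_mon_eq (E := E) (S := S) (w := w ++ [s]) (by simp [h])
  obtain ⟨l₁, l', rfl, rfl, e1⟩ := List.map_eq_append_iff.1 e
  obtain ⟨x, l₂, rfl, rfl, e2⟩ := List.map_eq_cons_iff.1 e1
  obtain rfl := List.map_eq_nil_iff.1 e2
  exact ⟨x, hl.maxIn, rfl, by simp [hl.erase.mon_eq]⟩

theorem exists_minIn_of_mon_eq {Z : Co C} {s : P} (h : E.mon S = Co.gen C s * Z) :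
    ∃ x, E.MinIn S x ∧ E.label x = s ∧ E.mon (S \ {x}) = Z := by
  obtain ⟨w, rfl⟩ := Co.exists_word Z
  obtain ⟨l, hl, e⟩ := exists_isListing_of_mon_eq (E := E) (S := S) (w := s :: w) (by simp [h])
  obtain ⟨x, l₂, rfl, rfl, rfl⟩ := List.map_eq_cons_iff.1 e
  refine ⟨x, ⟨(hl.mem x).1 (by simp), fun y hy hR => ?_⟩, rfl, ?_⟩
  · rcases List.mem_cons.1 ((hl.mem y).2 hy) with rfl | hy
    · exact R_irrefl _ hR
    · exact List.rel_of_pairwise_cons hl.pairwise hy hR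
  · simp [(IsListing.erase (l₁ := []) hl).mon_eq]

/-- Two vertices of `S` with the same label and no vertex of the subheap on `S` in between. -/
structure IsPair (S : Set E.carrier) (x y : E.carrier) : Prop where
  left : x ∈ S
  right : y ∈ S
  rel : E.R x y
  label_eq : E.label x = E.label y
  between : ∀ u ∈ S, E.R x u → ¬ E.R u y

/-- Two vertices of `S` with the same label and one vertex of the subheap on `S` in between,
which has another label. -/
structure IsTrip (S : Set E.carrier) (x y z : E.carrier) : Prop where
  left : x ∈ S
  mid : y ∈ S
  right : z ∈ S
  rel_left : E.R x y
  rel_right : E.R y z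
  label_eq : E.label x = E.label z
  label_ne : E.label y ≠ E.label x
  between : ∀ u ∈ S, E.R x u → E.R u z → u = y

/-- In a listing `A x M y B`, a letter of `M` concurrent with the common label would lie between `x`
and `y`. So `y` commutes through `M` and meets `x`. -/
theorem IsPair.exists_mon {x y : E.carrier} (h : IsPair S x y) :
    ∃ X Y s, E.mon S = X * Co.gen C s * Co.gen C s * Y ∧
      E.mon (S \ {x}) = X * Co.gen C s * Y ∧ E.mon (S \ {y}) = X * Co.gen C s * Y := by
  obtain ⟨A, T, hl⟩ := exists_isListing_append h.left
  obtain ⟨M, B, rfl⟩ := List.append_of_mem (hl.mem_of_R h.right h.rel)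
  have hl' : E.IsListing S ((A ++ x :: M) ++ y :: B) := by simpa using hl
  have hc : Co.gen C (E.label y) * Co.word C (M.map E.label) =
      Co.word C (M.map E.label) * Co.gen C (E.label y) := by
    refine Co.gen_commute_word fun q hq hC => ?_
    obtain ⟨u, hu, rfl⟩ := List.mem_map.1 hq
    exact h.between u ((hl.mem u).1 (by simp [hu])) (hl.R_right (by simp [hu]) (h.label_eq ▸ hC))
      (hl'.R_left (by simp [hu]) (C.symm _ _ hC))
  have hc' : ∀ Z, Co.gen C (E.label y) * (Co.word C (M.map E.label) * Z) =
      Co.word C (M.map E.label) * (Co.gen C (E.label y) * Z) := fun Z => by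
    rw [← mul_assoc, hc, mul_assoc]
  refine ⟨Co.word C (A.map E.label) * Co.word C (M.map E.label), Co.word C (B.map E.label),
    E.label y, ?_, ?_, ?_⟩
  · rw [hl.mon_eq]
    simp only [List.map_append, List.map_cons, Co.word_append, Co.word_cons, h.label_eq, mul_assoc,
      hc']
  · simp [hl.erase.mon_eq, mul_assoc]
  · rw [hl'.erase.mon_eq]
    simp only [List.map_append, List.map_cons, Co.word_append, Co.word_cons, h.label_eq, mul_assoc,
      hc']

theorem sdiff_pair_eq (S : Set E.carrier) (x y : E.carrier) : S \ {x, y} = (S \ {x}) \ {y} := by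
  ext u; simp; tauto

theorem sdiff_pair_eq' (S : Set E.carrier) (x y : E.carrier) : S \ {x, y} = (S \ {y}) \ {x} := by
  ext u; simp; tauto

/-- In a listing `A x M y N z B`, nothing in `M` or `N` is concurrent with the label of the ends, so
the ends slide next to `y`. Either end may be the one that survives the contraction, and the
resulting monomial is the same. -/
theorem IsTrip.exists_mon {x y z : E.carrier} (h : IsTrip S x y z) :
    ∃ X Y s t, s ≠ t ∧ C.rel s t ∧
      E.mon S = X * Co.gen C s * Co.gen C t * Co.gen C s * Y ∧
      E.mon (S \ {y, z}) = X * Co.gen C s * Y ∧ E.mon (S \ {x, y}) = X * Co.gen C s * Y := by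
  obtain ⟨A, T, hl⟩ := exists_isListing_append h.left
  obtain ⟨M, B, rfl⟩ := List.append_of_mem (hl.mem_of_R h.mid h.rel_left)
  have hl₁ : E.IsListing S ((A ++ x :: M) ++ y :: B) := by simpa using hl
  obtain ⟨N, B, rfl⟩ := List.append_of_mem (hl₁.mem_of_R h.right h.rel_right)
  have hl₂ : E.IsListing S ((A ++ x :: M ++ y :: N) ++ z :: B) := by simpa using hl
  have hc : ∀ L : List E.carrier, (∀ u ∈ L, u ∈ M ∨ u ∈ N) →
      Co.gen C (E.label z) * Co.word C (L.map E.label) =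
      Co.word C (L.map E.label) * Co.gen C (E.label z) := by
    intro L hL
    refine Co.gen_commute_word fun q hq hC => ?_
    obtain ⟨u, hu, rfl⟩ := List.mem_map.1 hq
    have hu := hL u hu
    have : u = y := h.between u ((hl.mem u).1 (by simp; tauto))
      (hl.R_right (by simp; tauto) (h.label_eq ▸ hC))
      (hl₂.R_left (by simp; tauto) (C.symm _ _ hC))
    subst this
    have hn := hl₁.nodup
    simp only [List.nodup_append, List.nodup_cons, List.mem_append, List.mem_cons] at hn
    rcases hu with hu | hu
    · exact hn.2.2 u (.inr (.inr hu)) u (.inl rfl) rfl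
    · exact hn.2.1.1 (.inl hu)
  have hM := hc M fun _ => .inl
  have hN := hc N fun _ => .inr
  have hMN := hc (M ++ N) fun _ => List.mem_append.1
  have hM' : ∀ Z, Co.gen C (E.label z) * (Co.word C (M.map E.label) * Z) =
      Co.word C (M.map E.label) * (Co.gen C (E.label z) * Z) := fun Z => by
    rw [← mul_assoc, hM, mul_assoc]
  have hN' : ∀ Z, Co.gen C (E.label z) * (Co.word C (N.map E.label) * Z) =
      Co.word C (N.map E.label) * (Co.gen C (E.label z) * Z) := fun Z => by
    rw [← mul_assoc, hN, mul_assoc]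
  refine ⟨Co.word C (A.map E.label) * Co.word C (M.map E.label),
    Co.word C (N.map E.label) * Co.word C (B.map E.label),
    E.label z, E.label y, ?_, ?_, ?_, ?_, ?_⟩
  · exact h.label_eq ▸ h.label_ne.symm
  · exact C.symm _ _ h.rel_right.rel
  · rw [hl.mon_eq]
    simp only [List.map_append, List.map_cons, Co.word_append, Co.word_cons, h.label_eq, mul_assoc,
      hM', hN']
  · have h₁ := hl₂.erase
    have h₂ : E.IsListing ((S \ {z}) \ {y}) ((A ++ x :: M) ++ (N ++ B)) :=
      IsListing.erase (l₁ := A ++ x :: M) (v := y) (l₂ := N ++ B) (by simpa using h₁)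
    rw [sdiff_pair_eq', h₂.mon_eq]
    simp only [List.map_append, List.map_cons, Co.word_append, Co.word_cons, h.label_eq, mul_assoc,
      hM']
  · have h₁ := hl₁.erase
    have h₂ : E.IsListing ((S \ {y}) \ {x}) (A ++ (M ++ (N ++ z :: B))) :=
      IsListing.erase (l₁ := A) (v := x) (by simpa using h₁)
    rw [sdiff_pair_eq', h₂.mon_eq]
    simp only [List.map_append, List.map_cons, Co.word_append, Co.word_cons, mul_assoc, hN']

theorem exists_isPair_of_mon_eq {X Y : Co C} {s : P}
    (h : E.mon S = X * Co.gen C s * Co.gen C s * Y) :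
    ∃ x y, IsPair S x y ∧ E.mon (S \ {y}) = X * Co.gen C s * Y := by
  obtain ⟨w, rfl⟩ := Co.exists_word X
  obtain ⟨w', rfl⟩ := Co.exists_word Y
  obtain ⟨l, hl, e⟩ := exists_isListing_of_mon_eq (E := E) (S := S) (w := w ++ s :: s :: w') (by simp [h, mul_assoc])
  obtain ⟨A, l', rfl, rfl, e1⟩ := List.map_eq_append_iff.1 e
  obtain ⟨x, l', rfl, rfl, e2⟩ := List.map_eq_cons_iff.1 e1
  obtain ⟨y, B, rfl, hxy, rfl⟩ := List.map_eq_cons_iff.1 e2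
  have hl' : E.IsListing S ((A ++ [x]) ++ y :: B) := by simpa using hl
  refine ⟨x, y, ⟨(hl.mem x).1 (by simp), (hl.mem y).1 (by simp),
    hl.R_right (by simp) (hxy ▸ C.refl _), hxy.symm, fun u hu h₁ h₂ => ?_⟩, ?_⟩
  · rcases List.mem_cons.1 (hl.mem_of_R hu h₁) with rfl | hu'
    · exact R_irrefl _ h₂
    · exact (hl'.R_right hu' (C.symm _ _ h₂.rel)).asymm h₂
  · simp [hl'.erase.mon_eq, mul_assoc]

theorem exists_isTrip_of_mon_eq {X Y : Co C} {s t : P} (hne : s ≠ t) (hC : C.rel s t)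
    (h : E.mon S = X * Co.gen C s * Co.gen C t * Co.gen C s * Y) :
    ∃ x y z, IsTrip S x y z ∧ E.mon (S \ {y, z}) = X * Co.gen C s * Y := by
  obtain ⟨w, rfl⟩ := Co.exists_word X
  obtain ⟨w', rfl⟩ := Co.exists_word Y
  obtain ⟨l, hl, e⟩ := exists_isListing_of_mon_eq (E := E) (S := S) (w := w ++ s :: t :: s :: w')
    (by simp [h, mul_assoc])
  obtain ⟨A, l', rfl, rfl, e1⟩ := List.map_eq_append_iff.1 e
  obtain ⟨x, l', rfl, rfl, e2⟩ := List.map_eq_cons_iff.1 e1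
  obtain ⟨y, l', rfl, rfl, e3⟩ := List.map_eq_cons_iff.1 e2
  obtain ⟨z, B, rfl, hxz, rfl⟩ := List.map_eq_cons_iff.1 e3
  have hl₁ : E.IsListing S ((A ++ [x]) ++ y :: z :: B) := by simpa using hl
  have hl₂ : E.IsListing S ((A ++ [x, y]) ++ z :: B) := by simpa using hl
  refine ⟨x, y, z, ⟨(hl.mem x).1 (by simp), (hl.mem y).1 (by simp), (hl.mem z).1 (by simp),
    hl.R_right (by simp) hC, hl₁.R_right (by simp) (hxz ▸ C.symm _ _ hC), hxz.symm, hne.symm,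
    fun u hu h₁ h₂ => ?_⟩, ?_⟩
  · rcases List.mem_cons.1 (hl.mem_of_R hu h₁) with rfl | hu'
    · rfl
    · rcases List.mem_cons.1 hu' with rfl | hu'
      · exact absurd h₂ (R_irrefl _)
      · exact absurd h₂ (hl₂.R_right hu' (C.symm _ _ h₂.rel)).asymm
  · have h₂ : E.IsListing ((S \ {y}) \ {z}) ((A ++ [x]) ++ B) :=
      IsListing.erase (by simpa using hl₁.erase)
    rw [sdiff_pair_eq, h₂.mon_eq]
    simp [mul_assoc]

end LabelledHeap

/-! ### Irreducible monomials and property P2. -/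

namespace Co

variable {P : Type u} {C : Concurrency P}

/-- A monomial with no factor `s s`, nor `s t s` with `s ≠ t` concurrent. -/
def IsIrr (m : Co C) : Prop :=
  (∀ X Y s, m ≠ X * gen C s * gen C s * Y) ∧
    ∀ X Y s t, s ≠ t → C.rel s t → m ≠ X * gen C s * gen C t * gen C s * Y

theorem IsIrr.of_mul {A m B : Co C} (h : IsIrr (A * m * B)) : IsIrr m := by
  refine ⟨fun X Y s e => h.1 (A * X) (Y * B) s ?_, fun X Y s t h₁ h₂ e =>
    h.2 (A * X) (Y * B) s t h₁ h₂ ?_⟩ <;> simp only [e, mul_assoc]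

theorem IsIrr.of_mul_right {m B : Co C} (h : IsIrr (m * B)) : IsIrr m :=
  IsIrr.of_mul (A := 1) (B := B) (by simpa using h)

theorem IsIrr.of_mul_left {A m : Co C} (h : IsIrr (A * m)) : IsIrr m :=
  IsIrr.of_mul (A := A) (B := 1) (by simpa using h)

theorem IsIrr.rev {m : Co C} (h : IsIrr m) : IsIrr m.rev := by
  refine ⟨fun X Y s e => h.1 Y.rev X.rev s ?_, fun X Y s t h₁ h₂ e =>
    h.2 Y.rev X.rev s t h₁ h₂ ?_⟩ <;> rw [← rev_rev m, e] <;> simp [mul_assoc]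

end Co

namespace LabelledHeap

variable {P : Type u} {C : Concurrency P} {E : LabelledHeap C} {S : Set E.carrier}

theorem isIrr_mon_iff : (E.mon S).IsIrr ↔
    (∀ x y, ¬ IsPair S x y) ∧ ∀ x y z, ¬ IsTrip S x y z := by
  constructor
  · intro h
    constructor
    · intro x y hp
      obtain ⟨X, Y, s, e, -⟩ := hp.exists_mon
      exact h.1 _ _ _ e
    · intro x y z hp
      obtain ⟨X, Y, s, t, h₁, h₂, e, -⟩ := hp.exists_mon
      exact h.2 _ _ _ _ h₁ h₂ e
  · intro h
    constructor
    · intro X Y s e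
      obtain ⟨x, y, hp, -⟩ := exists_isPair_of_mon_eq e
      exact h.1 _ _ hp
    · intro X Y s t h₁ h₂ e
      obtain ⟨x, y, z, hp, -⟩ := exists_isTrip_of_mon_eq h₁ h₂ e
      exact h.2 _ _ _ hp

variable (E) in
/-- Any two vertices of `S` with the same label have at least two vertices of `S` with concurrent
labels in between. -/
def TwoBetween (S : Set E.carrier) : Prop :=
  ∀ x ∈ S, ∀ z ∈ S, E.R x z → E.label x = E.label z →
    ∃ u ∈ S, ∃ w ∈ S, u ≠ w ∧ E.R x u ∧ E.R u z ∧ E.R x w ∧ E.R w z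

theorem TwoBetween.isIrr (h : E.TwoBetween S) : (E.mon S).IsIrr := by
  refine isIrr_mon_iff.2 ⟨fun x y hp => ?_, fun x y z hp => ?_⟩
  · obtain ⟨u, hu, -, -, -, h₁, h₂, -⟩ := h x hp.left y hp.right hp.rel hp.label_eq
    exact hp.between u hu h₁ h₂
  · obtain ⟨u, hu, w, hw, hne, h₁, h₂, h₃, h₄⟩ := h x hp.left z hp.right
      (hp.rel_left.trans_of_eq hp.rel_right (.inr (.inr hp.label_eq))) hp.label_eq
    exact hne ((hp.between u hu h₁ h₂).trans (hp.between w hw h₃ h₄).symm)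

theorem twoBetween_iff : E.TwoBetween S ↔ (E.mon S).IsIrr := by
  refine ⟨fun h => h.isIrr, fun h x hx z hz hR hl => ?_⟩
  rw [isIrr_mon_iff] at h
  by_contra hcon
  push Not at hcon
  have key : ∀ u ∈ S, ∀ w ∈ S, E.R x u → E.R u z → E.R x w → E.R w z → u = w := by
    intro u hu w hw h₁ h₂ h₃ h₄
    by_contra hne
    exact hcon u hu w hw hne h₁ h₂ h₃ h₄
  by_cases hy : ∃ y ∈ S, E.R x y ∧ E.R y z
  · obtain ⟨y, hy, h₁, h₂⟩ := hy
    -- If the only vertex in between repeats the label, then `x` and `y` have nothing between them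
    -- and already form a pair.
    by_cases hly : E.label y = E.label x
    · refine h.1 x y ⟨hx, hy, h₁, hly.symm, fun u hu h₃ h₄ => h₄.ne ?_⟩
      exact key u hu y hy h₃ (h₄.trans_of_eq h₂ (.inr (.inl (hly.trans hl)))) h₁ h₂
    · exact h.2 x y z ⟨hx, hy, hz, h₁, h₂, hl, hly, fun u hu h₃ h₄ => key u hu y hy h₃ h₄ h₁ h₂⟩
  · push Not at hy
    exact h.1 x z ⟨hx, hz, hR, hl, hy⟩

/-- Convexity refers to the whole order, `TwoBetween` only to `R`. They agree because a vertex in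
the interval between equally labelled ends yields a first and a last step that are concurrent with
both ends. -/
theorem hasP2_iff_twoBetween : E.HasP2 ↔ E.TwoBetween Set.univ := by
  constructor
  · intro h
    rw [twoBetween_iff, isIrr_mon_iff]
    constructor
    · intro x y hp
      have hint : ∀ w, x < w → ¬ w < y := by
        intro w h₁ h₂
        obtain ⟨u, h₃, h₄⟩ := exists_R_le_of_lt h₁
        exact hp.between u trivial h₃
          ⟨h₄.trans_lt h₂, C.symm _ _ (hp.label_eq ▸ h₃.rel)⟩
      refine (h [x, y] ⟨by simp, by simpa using hp.rel.lt, ?_⟩ ⟨by simp, by simpa using hp.label_eq⟩).1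
        rfl
      intro a ha b hb w h₁ h₂
      simp only [List.mem_cons, List.not_mem_nil, or_false] at ha hb
      have := hp.rel.lt
      rcases ha with rfl | rfl <;> rcases hb with rfl | rfl
      · exact absurd (h₁.trans h₂) (lt_irrefl _)
      · exact absurd h₂ (hint w h₁)
      · exact absurd ((h₁.trans h₂).trans this) (lt_irrefl _)
      · exact absurd (h₁.trans h₂) (lt_irrefl _)
    · intro x y z hp
      have hxy := hp.rel_left.lt
      have hyz := hp.rel_right.lt
      -- The first step from `x` towards `w` and the last step from `w` to `z` both equal `y`, which
      -- squeezes `w`.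
      have hint : ∀ w, x < w → w < z → w = y := by
        intro w h₁ h₂
        obtain ⟨u, h₃, h₄⟩ := exists_R_le_of_lt h₁
        obtain ⟨u', h₅, h₆⟩ := exists_le_R_of_lt h₂
        have e₁ := hp.between u trivial h₃
          ⟨h₄.trans_lt h₂, C.symm _ _ (hp.label_eq ▸ h₃.rel)⟩
        have e₂ := hp.between u' trivial ⟨h₁.trans_le h₅, C.symm _ _ (hp.label_eq ▸ h₆.rel)⟩ h₆
        subst e₁ e₂
        exact le_antisymm h₅ h₄
      refine (h [x, y, z] ⟨by simp, by simp [hxy, hyz, hxy.trans hyz], ?_⟩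
        ⟨by simp, by simpa using hp.label_eq⟩).2 rfl
      intro a ha b hb w h₁ h₂
      have ha' : x ≤ a := by
        simp only [List.mem_cons, List.not_mem_nil, or_false] at ha
        rcases ha with rfl | rfl | rfl
        exacts [le_rfl, hxy.le, (hxy.trans hyz).le]
      have hb' : b ≤ z := by
        simp only [List.mem_cons, List.not_mem_nil, or_false] at hb
        rcases hb with rfl | rfl | rfl
        exacts [(hxy.trans hyz).le, hyz.le, le_rfl]
      simp [hint w (ha'.trans_lt h₁) (h₂.trans_le hb')]
  · intro h c hc hb
    obtain ⟨hne, hl⟩ := hb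
    constructor
    · intro hlen
      obtain ⟨x, y, rfl⟩ := List.length_eq_two.1 hlen
      have hxy : x < y := by simpa using hc.2.1
      simp only [List.head_cons, List.getLast_cons_cons, List.getLast_singleton] at hl
      obtain ⟨u, -, -, -, -, h₁, h₂, -⟩ := h x trivial y trivial (R_of_lt_of_eq hxy hl) hl
      have := hc.2.2 x (by simp) y (by simp) u h₁.lt h₂.lt
      simp only [List.mem_cons, List.not_mem_nil, or_false] at this
      exact this.elim h₁.ne.symm h₂.ne
    · intro hlen
      obtain ⟨x, y, z, rfl⟩ := List.length_eq_three.1 hlen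
      have hp := hc.2.1
      simp only [List.pairwise_cons, List.mem_cons, List.not_mem_nil, or_false] at hp
      have hxz : x < z := hp.1 z (.inr rfl)
      simp only [List.head_cons, List.getLast_cons_cons, List.getLast_singleton] at hl
      obtain ⟨u, -, w, -, hne, h₁, h₂, h₃, h₄⟩ := h x trivial z trivial (R_of_lt_of_eq hxz hl) hl
      have e₁ := hc.2.2 x (by simp) z (by simp) u h₁.lt h₂.lt
      have e₂ := hc.2.2 x (by simp) z (by simp) w h₃.lt h₄.lt
      simp only [List.mem_cons, List.not_mem_nil, or_false] at e₁ e₂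
      exact hne (((e₁.resolve_left h₁.ne.symm).resolve_right h₂.ne).trans
        ((e₂.resolve_left h₃.ne.symm).resolve_right h₄.ne).symm)

theorem hasP2_iff : E.HasP2 ↔ E.monomial.IsIrr := by
  rw [hasP2_iff_twoBetween, twoBetween_iff, mon_univ]

/-- The labelled heap on a finite set of labelled vertices with distinct positions. -/
def ofPos (C : Concurrency P) (V : Type) [Finite V] (label : V → P) (pos : V → ℕ)
    (hpos : Function.Injective pos) : LabelledHeap C where
  carrier := V
  finite := inferInstance
  order :=
    { le := Relation.TransGen fun a b => pos a ≤ pos b ∧ C.rel (label a) (label b)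
      le_refl := fun a => Relation.TransGen.single ⟨le_rfl, C.refl _⟩
      le_trans := fun _ _ _ h h' => h.trans h'
      le_antisymm := by
        have key : ∀ a b, Relation.TransGen (fun a b => pos a ≤ pos b ∧ C.rel (label a) (label b))
            a b → pos a ≤ pos b := by
          intro a b h
          induction h with
          | single h => exact h.1
          | tail _ h ih => exact ih.trans h.1
        exact fun a b h h' => hpos (le_antisymm (key a b h) (key b a h')) }
  label := label
  comparable := fun a b h => (le_total (pos a) (pos b)).imp
    (fun h' => Relation.TransGen.single ⟨h', h⟩)
    fun h' => Relation.TransGen.single ⟨h', C.symm _ _ h⟩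
  le_iff := fun a b => by
    constructor
    · intro h
      induction h with
      | single h => exact Relation.TransGen.single ⟨Relation.TransGen.single h, h.2⟩
      | tail _ h ih => exact ih.tail ⟨Relation.TransGen.single h, h.2⟩
    · intro h
      induction h with
      | single h => exact h.1
      | tail _ h ih => exact Relation.TransGen.trans ih h.1

theorem ofPos_R {V : Type} [Finite V] {label : V → P} {pos : V → ℕ}
    {hpos : Function.Injective pos} (a b : V) :
    (ofPos C V label pos hpos).R a b ↔ pos a < pos b ∧ C.rel (label a) (label b) := by
  have key : ∀ a b : V, pos a < pos b → C.rel (label a) (label b) →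
      (ofPos C V label pos hpos).R a b := by
    intro a b h h'
    refine ⟨lt_of_le_of_ne (Relation.TransGen.single ⟨h.le, h'⟩ :
      (ofPos C V label pos hpos).order.le a b) ?_, h'⟩
    rintro rfl
    exact h.false
  refine ⟨fun h => ⟨?_, h.rel⟩, fun h => key a b h.1 h.2⟩
  by_contra hlt
  rcases (not_lt.1 hlt).lt_or_eq with h' | h'
  · exact h.asymm (key b a h' (C.symm _ _ h.rel))
  · exact h.ne (hpos h'.symm)

theorem exists_monomial_eq (m : Co C) : ∃ E : LabelledHeap C, E.monomial = m := by
  obtain ⟨w, rfl⟩ := Co.exists_word m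
  let E := ofPos C (Fin w.length) w.get Fin.val Fin.val_injective
  refine ⟨E, ?_⟩
  have h : E.IsListing Set.univ (List.finRange w.length : List (Fin w.length)) := by
    refine ⟨List.nodup_finRange _, fun x => ⟨fun _ => trivial, fun _ => List.mem_finRange _⟩, ?_⟩
    refine (List.pairwise_lt_finRange _).imp fun {a b} hab hR => ?_
    exact absurd ((ofPos_R b a).1 hR).1 (not_lt.2 hab.le)
  rw [← mon_univ, h.mon_eq]
  exact congrArg _ (List.map_get_finRange w)

end LabelledHeap

theorem TL.isBasisMonomial_iff {P : Type u} {C : Concurrency P} (m : Co C) :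
    TL.IsBasisMonomial C m ↔ m.IsIrr := by
  constructor
  · rintro ⟨E, h, rfl⟩
    exact LabelledHeap.hasP2_iff.1 h
  · intro h
    obtain ⟨E, rfl⟩ := LabelledHeap.exists_monomial_eq m
    exact ⟨E, LabelledHeap.hasP2_iff.2 h, rfl⟩

/-! ### Confluence of the contractions `s t s → s`. -/

namespace Co

variable {P : Type u} {C : Concurrency P}

/-- The monomials that can be reduced to one satisfying `IsIrr` by replacing factors `s t s` by
`s`, where `s ≠ t` are concurrent. -/
inductive Reducible : Co C → Prop
  | irr {m : Co C} : m.IsIrr → Reducible m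
  | step (X : Co C) (s t : P) (Y : Co C) : s ≠ t → C.rel s t → Reducible (X * gen C s * Y) →
      Reducible (X * gen C s * gen C t * gen C s * Y)

theorem Reducible.rev {m : Co C} (h : m.Reducible) : m.rev.Reducible := by
  induction h with
  | irr h => exact .irr h.rev
  | step X s t Y h₁ h₂ _ ih =>
    have := Reducible.step Y.rev s t X.rev h₁ h₂ (by simpa [mul_assoc] using ih)
    simpa [mul_assoc] using this

end Co

namespace LabelledHeap

variable {P : Type u} {C : Concurrency P} {E : LabelledHeap C} {S : Set E.carrier}

theorem IsPair.mono {T : Set E.carrier} {x y : E.carrier} (h : IsPair S x y) (hT : T ⊆ S)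
    (hx : x ∈ T) (hy : y ∈ T) : IsPair T x y :=
  ⟨hx, hy, h.rel, h.label_eq, fun u hu => h.between u (hT hu)⟩

theorem IsTrip.mono {T : Set E.carrier} {x y z : E.carrier} (h : IsTrip S x y z) (hT : T ⊆ S)
    (hx : x ∈ T) (hy : y ∈ T) (hz : z ∈ T) : IsTrip T x y z :=
  ⟨hx, hy, hz, h.rel_left, h.rel_right, h.label_eq, h.label_ne, fun u hu => h.between u (hT hu)⟩

theorem IsTrip.rel {x y z : E.carrier} (h : IsTrip S x y z) : E.R x z :=
  h.rel_left.trans_of_eq h.rel_right (.inr (.inr h.label_eq))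

theorem IsTrip.mon_eq {x y z : E.carrier} (h : IsTrip S x y z) :
    E.mon (S \ {x, y}) = E.mon (S \ {y, z}) := by
  obtain ⟨X, Y, s, t, -, -, -, h₁, h₂⟩ := h.exists_mon
  rw [h₁, h₂]

theorem IsTrip.reducible {x y z : E.carrier} (h : IsTrip S x y z)
    (h' : (E.mon (S \ {y, z})).Reducible) : (E.mon S).Reducible := by
  obtain ⟨X, Y, s, t, h₁, h₂, e₁, e₂, -⟩ := h.exists_mon
  rw [e₁]
  exact .step _ _ _ _ h₁ h₂ (e₂ ▸ h')

/-- The middle vertex of a triple with ends labelled `s` belongs to no pair. -/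
theorem IsTrip.mid_ne {x y z p q : E.carrier} (h : IsTrip S x y z) (hp : IsPair S p q) :
    y ≠ p ∧ y ≠ q := by
  constructor
  · rintro rfl
    have hC : C.rel (E.label q) (E.label z) := hp.label_eq ▸ h.rel_right.rel
    have hne : q ≠ z := fun e => h.label_ne (by rw [hp.label_eq, e, h.label_eq])
    rcases R_total hne hC with h' | h'
    · exact hp.rel.ne (h.between q hp.right
        (h.rel_left.trans_of_eq hp.rel (.inr (.inl hp.label_eq))) h').symm
    · exact hp.between z h.right h.rel_right h'
  · rintro rfl
    have hC : C.rel (E.label p) (E.label x) := hp.label_eq ▸ C.symm _ _ h.rel_left.rel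
    have hne : p ≠ x := fun e => h.label_ne (by rw [← hp.label_eq, e])
    rcases R_total hne hC with h' | h'
    · exact hp.between x h.left h' h.rel_left
    · exact hp.rel.ne (h.between p hp.left h'
        (hp.rel.trans_of_eq h.rel_right (.inl hp.label_eq)))

/-- Pairs persist when a triple is contracted. -/
theorem IsTrip.exists_isPair {x y z p q : E.carrier} (h : IsTrip S x y z) (hp : IsPair S p q) :
    (∃ p q, IsPair (S \ {x, y}) p q) ∨ ∃ p q, IsPair (S \ {y, z}) p q := by
  obtain ⟨h₁, h₂⟩ := h.mid_ne hp
  -- A pair cannot contain both ends of the triple, so one of the two contractions leaves it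
  -- untouched.
  by_cases hz : p = z ∨ q = z
  · left
    have hx : p ≠ x ∧ q ≠ x := by
      constructor
      · rintro rfl
        obtain rfl := hz.resolve_left h.rel.ne
        exact hp.between y h.mid h.rel_left h.rel_right
      · rintro rfl
        obtain rfl := hz.resolve_right h.rel.ne
        exact hp.rel.asymm h.rel
    exact ⟨p, q, hp.mono Set.sdiff_subset ⟨hp.left, by simp [hx.1, h₁.symm]⟩
      ⟨hp.right, by simp [hx.2, h₂.symm]⟩⟩
  · right
    push Not at hz
    exact ⟨p, q, hp.mono Set.sdiff_subset ⟨hp.left, by simp [hz.1, h₁.symm]⟩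
      ⟨hp.right, by simp [hz.2, h₂.symm]⟩⟩

/-- A pair would survive every contraction, up to the choice of the removed end, and so reach an
irreducible monomial. -/
theorem not_isPair_of_reducible {m : Co C} (h : m.Reducible) :
    ∀ S : Set E.carrier, E.mon S = m → ∀ p q, ¬ IsPair S p q := by
  induction h with
  | irr h =>
    rintro S rfl
    exact (isIrr_mon_iff.1 h).1
  | step X s t Y h₁ h₂ _ ih =>
    intro S e p q hp
    obtain ⟨x, y, z, ht, e'⟩ := exists_isTrip_of_mon_eq h₁ h₂ e
    rcases ht.exists_isPair hp with ⟨p', q', h'⟩ | ⟨p', q', h'⟩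
    · exact ih _ (ht.mon_eq.trans e') _ _ h'
    · exact ih _ e' _ _ h'

/-- If the right ends differ, the nearer one lies inside the other triple and must be its middle;
but it carries the label of the ends. -/
theorem IsTrip.mid_eq_of_left {x y z y' z' : E.carrier} (h : IsTrip S x y z)
    (h' : IsTrip S x y' z') : y = y' := by
  by_cases hz : z = z'
  · subst hz
    exact h'.between y h.mid h.rel_left h.rel_right
  · have hl : E.label z = E.label z' := h.label_eq.symm.trans h'.label_eq
    rcases R_total hz (hl ▸ C.refl _) with hR | hR
    · exact absurd (h'.between z h.right h.rel hR ▸ h.label_eq.symm) h'.label_ne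
    · exact absurd (h.between z' h'.right h'.rel hR ▸ h'.label_eq.symm) h.label_ne

theorem IsTrip.mid_eq_of_right {x y z x' y' : E.carrier} (h : IsTrip S x y z)
    (h' : IsTrip S x' y' z) : y = y' := by
  by_cases hx : x = x'
  · subst hx
    exact h'.between y h.mid h.rel_left h.rel_right
  · have hl : E.label x = E.label x' := h.label_eq.trans h'.label_eq.symm
    rcases R_total hx (hl ▸ C.refl _) with hR | hR
    · exact absurd (h.between x' h'.left hR h'.rel ▸ hl.symm) h.label_ne
    · exact absurd (h'.between x h.left hR h.rel ▸ hl) h'.label_ne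

theorem IsTrip.right_eq_of_mid {x y z x' z' : E.carrier} (h : IsTrip S x y z)
    (h' : IsTrip S x' y z') (hl : E.label x = E.label x') : z = z' := by
  by_contra hz
  have hl' : E.label z = E.label z' := by rw [← h.label_eq, hl, h'.label_eq]
  rcases R_total hz (hl' ▸ C.refl _) with hR | hR
  · have := h'.between z h.right
      (h'.rel_left.trans_of_eq h.rel_right (.inr (.inr (by rw [← hl, h.label_eq])))) hR
    exact h.rel_right.ne this.symm
  · have := h.between z' h'.right
      (h.rel_left.trans_of_eq h'.rel_right (.inr (.inr (by rw [hl, h'.label_eq])))) hR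
    exact h'.rel_right.ne this.symm

/-- Triples that overlap in this way spell `s t s t`: the right end of one is the middle of the
other. -/
theorem IsTrip.mid_eq_of_mid_eq_left {x y z y' z' : E.carrier} (h : IsTrip S x y z)
    (h' : IsTrip S y y' z') : y' = z := by
  have hC : C.rel (E.label z) (E.label z') := h'.label_eq ▸ C.symm _ _ h.rel_right.rel
  have hne : z ≠ z' := fun e => h.label_ne (by rw [h'.label_eq, ← e, h.label_eq])
  rcases R_total hne hC with hR | hR
  · exact (h'.between z h.right h.rel_right hR).symm
  · exact absurd (h.between z' h'.right
      (h.rel_left.trans_of_eq h'.rel (.inr (.inl h'.label_eq))) hR) h'.rel.ne.symm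

theorem IsTrip.mid_eq_of_mid_eq_right {x y z x' y' : E.carrier} (h : IsTrip S x y z)
    (h' : IsTrip S x' y' y) : y' = x := by
  have hC : C.rel (E.label x) (E.label x') := h'.label_eq ▸ h.rel_left.rel
  have hne : x ≠ x' := fun e => h.label_ne (by rw [← h'.label_eq, ← e])
  rcases R_total hne hC with hR | hR
  · exact absurd (h.between x' h'.left hR
      (h'.rel.trans_of_eq h.rel_right (.inl h'.label_eq))) h'.rel.ne
  · exact (h'.between x h.left hR h.rel_left).symm

/-- Contractions of triples with disjoint removed parts commute. -/
theorem IsTrip.reducible_of_disjoint {x y z x' y' z' : E.carrier} {K K' : Set E.carrier}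
    (h : IsTrip S x y z) (h' : IsTrip S x' y' z') (hK : K = {y, z} ∨ K = {x, y})
    (hK' : K' = {y', z'} ∨ K' = {x', y'}) (hd : x' ∉ K ∧ y' ∉ K ∧ z' ∉ K)
    (hd' : x ∉ K' ∧ y ∉ K' ∧ z ∉ K')
    (ih : ∀ T : Set E.carrier, E.mon T = E.mon (S \ {y', z'}) → ∀ a b c, IsTrip T a b c →
      (E.mon (T \ {b, c})).Reducible) :
    (E.mon (S \ {y, z})).Reducible := by
  have hB : IsTrip (S \ K') x y z :=
    h.mono Set.sdiff_subset ⟨h.left, hd'.1⟩ ⟨h.mid, hd'.2.1⟩ ⟨h.right, hd'.2.2⟩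
  have hA : IsTrip (S \ K) x' y' z' :=
    h'.mono Set.sdiff_subset ⟨h'.left, hd.1⟩ ⟨h'.mid, hd.2.1⟩ ⟨h'.right, hd.2.2⟩
  have h₁ : (E.mon ((S \ K') \ K)).Reducible := by
    have := ih (S \ K') (by rcases hK' with rfl | rfl; exacts [rfl, h'.mon_eq]) x y z hB
    rcases hK with rfl | rfl
    · exact this
    · rwa [hB.mon_eq]
  have h₂ : (E.mon (S \ K)).Reducible := by
    refine hA.reducible ?_
    -- Both orders of contraction end in the same set, so reducibility found along one route
    -- transfers to the other.
    rw [sdiff_right_comm] at h₁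
    rcases hK' with rfl | rfl
    · exact h₁
    · rwa [← hA.mon_eq]
  rcases hK with rfl | rfl
  · exact h₂
  · rwa [← h.mon_eq]

/-- Local confluence: two triples have the same middle, or overlap as `s t s t`, or have disjoint
removed parts for a suitable choice of ends. In the first two cases the two contractions give the
same monomial, unless a square is left. -/
theorem IsTrip.reducible_of_reducible {x y z x' y' z' : E.carrier}
    (h : IsTrip S x y z) (h' : IsTrip S x' y' z')
    (hred : (E.mon (S \ {y', z'})).Reducible)
    (ih : ∀ T : Set E.carrier, E.mon T = E.mon (S \ {y', z'}) → ∀ a b c, IsTrip T a b c →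
      (E.mon (T \ {b, c})).Reducible) :
    (E.mon (S \ {y, z})).Reducible := by
  by_cases hy : y = y'
  · subst hy
    by_cases hl : E.label x = E.label x'
    · obtain rfl := h.right_eq_of_mid h' hl
      exact hred
    -- The second contraction removes the only vertex between `x` and `z` but keeps both of these,
    -- which leaves a pair in a reducible monomial.
    · refine absurd ⟨⟨h.left, ?_⟩, ⟨h.right, ?_⟩, h.rel, h.label_eq, fun u hu h₁ h₂ => ?_⟩
        (not_isPair_of_reducible hred _ rfl x z)
      · have : x ≠ z' := fun e => hl (by rw [e, h'.label_eq])
        simp [h.rel_left.ne, this]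
      · have : z ≠ z' := fun e => hl (by rw [h.label_eq, e, h'.label_eq])
        simp [h.rel_right.ne.symm, this]
      · exact hu.2 (by simp [h.between u hu.1 h₁ h₂])
  by_cases hyx : y = x'
  · subst hyx
    obtain rfl := h.mid_eq_of_mid_eq_left h'
    rwa [← h'.mon_eq] at hred
  by_cases hyz : y = z'
  · subst hyz
    obtain rfl := h.mid_eq_of_mid_eq_right h'
    rw [← h.mon_eq]
    exact hred
  have hyx' : y' ≠ x := by
    rintro rfl
    exact hyz (h'.mid_eq_of_mid_eq_left h)
  have hyz' : y' ≠ z := by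
    rintro rfl
    exact hyx (h'.mid_eq_of_mid_eq_right h)
  have hxx : x ≠ x' := by
    rintro rfl
    exact hy (h.mid_eq_of_left h')
  have hzz : z ≠ z' := by
    rintro rfl
    exact hy (h.mid_eq_of_right h')
  -- The triples can now share only an end, the right end of one being the left end of the other.
  -- That shared end is the one kept in both contractions.
  by_cases hzx : z = x'
  · have hxz : x ≠ z' := by
      rintro rfl
      subst hzx
      exact h.rel.asymm h'.rel
    exact h.reducible_of_disjoint h' (.inr rfl) (.inl rfl)
      (by simp; tauto) (by simp; tauto) ih
  · by_cases hxz : x = z'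
    · exact h.reducible_of_disjoint h' (.inl rfl) (.inr rfl)
        (by simp; tauto) (by simp; tauto) ih
    · exact h.reducible_of_disjoint h' (.inl rfl) (.inl rfl)
        (by simp; tauto) (by simp; tauto) ih

/-- Induction along one given reduction, whose first step is compared with the contraction of the
given triple. -/
theorem IsTrip.reducible_contract {m : Co C} (h : m.Reducible) :
    ∀ S : Set E.carrier, E.mon S = m → ∀ x y z, IsTrip S x y z →
      (E.mon (S \ {y, z})).Reducible := by
  induction h with
  | irr h =>
    rintro S rfl x y z ht
    exact absurd ht ((isIrr_mon_iff.1 h).2 x y z)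
  | step X s t Y h₁ h₂ hred ih =>
    intro S e x y z ht
    obtain ⟨x', y', z', ht', e'⟩ := exists_isTrip_of_mon_eq h₁ h₂ e
    exact ht.reducible_of_reducible ht' (e' ▸ hred) fun T hT => ih T (hT.trans e')

end LabelledHeap

namespace Co

variable {P : Type u} {C : Concurrency P}

theorem not_reducible_of_sq (X Y : Co C) (s : P) : ¬ (X * gen C s * gen C s * Y).Reducible := by
  intro h
  obtain ⟨E, hE⟩ := LabelledHeap.exists_monomial_eq (X * gen C s * gen C s * Y)
  rw [← LabelledHeap.mon_univ] at hE
  obtain ⟨x, y, hp, -⟩ := LabelledHeap.exists_isPair_of_mon_eq hE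
  exact LabelledHeap.not_isPair_of_reducible h _ hE x y hp

theorem reducible_braid_iff (X Y : Co C) {s t : P} (hne : s ≠ t) (hC : C.rel s t) :
    (X * gen C s * gen C t * gen C s * Y).Reducible ↔ (X * gen C s * Y).Reducible := by
  refine ⟨fun h => ?_, .step _ _ _ _ hne hC⟩
  obtain ⟨E, hE⟩ := LabelledHeap.exists_monomial_eq (X * gen C s * gen C t * gen C s * Y)
  rw [← LabelledHeap.mon_univ] at hE
  obtain ⟨x, y, z, hp, e⟩ := LabelledHeap.exists_isTrip_of_mon_eq hne hC hE
  rw [← e]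
  exact LabelledHeap.IsTrip.reducible_contract h _ hE x y z hp

end Co

/-! ### Detecting reducible monomials in the Temperley–Lieb algebra. -/

namespace TL

variable {P : Type u} {C : Concurrency P}

theorem ofCo_mul (m n : Co C) : ofCo C (m * n) = ofCo C m * ofCo C n := by
  simp only [ofCo, map_mul]

theorem ofCo_braid (X Y : Co C) {s t : P} (hne : s ≠ t) (hC : C.rel s t) :
    ofCo C (X * Co.gen C s * Co.gen C t * Co.gen C s * Y) = ofCo C (X * Co.gen C s * Y) := by
  have h : ofCo C (Co.gen C s * Co.gen C t * Co.gen C s) = ofCo C (Co.gen C s) :=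
    RingQuot.mkAlgHom_rel _ (TLRel.braid s t hne hC)
  simp only [ofCo_mul, mul_assoc] at h ⊢
  rw [← mul_assoc (ofCo C (Co.gen C t)), ← mul_assoc (ofCo C (Co.gen C s)), h]

/-- Specialization at `v = 1` modulo 2, where `δ` vanishes. -/
noncomputable def specialize : LaurentPolynomial ℤ →+* ZMod 2 :=
  LaurentPolynomial.eval₂ (Int.castRingHom (ZMod 2)) 1

theorem specialize_delta :
    specialize (LaurentPolynomial.T 1 + LaurentPolynomial.T (-1)) = 0 := by
  rw [specialize, map_add, LaurentPolynomial.eval₂_T, LaurentPolynomial.eval₂_T]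
  simp
  rfl

open Classical in
/-- The functional modulo 2 that detects the reducible monomials. -/
noncomputable def detect (C : Concurrency P) :
    MonoidAlgebra (LaurentPolynomial ℤ) (Co C) →+ ZMod 2 :=
  MonoidAlgebra.liftNC specialize.toAddMonoidHom fun m : Co C => if m.Reducible then 1 else 0

open Classical in
theorem detect_single (m : Co C) (a : LaurentPolynomial ℤ) :
    detect C (MonoidAlgebra.single m a) = specialize a * if m.Reducible then 1 else 0 := by
  exact MonoidAlgebra.liftNC_single _ _ _ _

/-- For `s s = δ s` both sides vanish: the left because a monomial with a square is not reducible,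
the right because `δ` specializes to 0. For `s t s = s` this is confluence. -/
theorem detect_rel {a b : MonoidAlgebra (LaurentPolynomial ℤ) (Co C)} (h : TLRel C a b)
    (x y : MonoidAlgebra (LaurentPolynomial ℤ) (Co C)) :
    detect C (x * a * y) = detect C (x * b * y) := by
  classical
  induction x using MonoidAlgebra.induction_linear with
  | zero => simp
  | add x x' h h' => simp only [add_mul, map_add, h, h']
  | single m c =>
    induction y using MonoidAlgebra.induction_linear with
    | zero => simp
    | add y y' h h' => simp only [mul_add, map_add, h, h']
    | single n d =>
      cases h with
      | sq s =>
        simp only [MonoidAlgebra.of_apply, MonoidAlgebra.smul_single, MonoidAlgebra.single_mul_single,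
          detect_single, map_mul, smul_eq_mul, specialize_delta]
        rw [if_neg (by simpa [mul_assoc] using Co.not_reducible_of_sq m n s)]
        simp
      | braid s t hne hC =>
        simp only [MonoidAlgebra.of_apply, MonoidAlgebra.single_mul_single, detect_single]
        have := Co.reducible_braid_iff m n hne hC
        simp only [mul_assoc] at this ⊢
        simp only [this]

/-- The factors on both sides are carried along so that the induction passes through closure under
multiplication. -/
theorem detect_ringQuotRel {a b : MonoidAlgebra (LaurentPolynomial ℤ) (Co C)}
    (h : RingQuot.Rel (TLRel C) a b) :
    ∀ x y, detect C (x * a * y) = detect C (x * b * y) := by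
  induction h with
  | of h => exact detect_rel h
  | add_left _ ih => intro x y; simp only [mul_add, add_mul, map_add, ih]
  | @mul_left a b c _ ih => intro x y; simpa only [mul_assoc] using ih x (c * y)
  | @mul_right a b c _ ih => intro x y; simpa only [mul_assoc] using ih (x * a) y

theorem detect_eq {a b : MonoidAlgebra (LaurentPolynomial ℤ) (Co C)}
    (h : RingQuot.mkAlgHom (LaurentPolynomial ℤ) (TLRel C) a =
      RingQuot.mkAlgHom (LaurentPolynomial ℤ) (TLRel C) b) :
    detect C a = detect C b := by
  have h' : RingQuot.mkRingHom (TLRel C) a = RingQuot.mkRingHom (TLRel C) b := by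
    rw [← RingQuot.mkAlgHom_coe (LaurentPolynomial ℤ)]
    exact h
  simp only [RingQuot.mkRingHom_def] at h'
  exact congrArg (Quot.lift (detect C) fun x y hxy => by simpa using detect_ringQuotRel hxy 1 1)
    (RingQuot.mk.inj h')

/-- An irreducible monomial is detected with value 1, so any monomial equal to it in the algebra is
detected too. This replaces the algebra by combinatorics from here on. -/
theorem ofCo_mem_monomialBasis_iff (m : Co C) : ofCo C m ∈ monomialBasis C ↔ m.Reducible := by
  classical
  constructor
  · rintro ⟨g, hg, e⟩
    have := detect_eq e
    simp only [MonoidAlgebra.of_apply, detect_single, map_one, one_mul] at this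
    rw [if_pos (.irr ((isBasisMonomial_iff g).1 hg))] at this
    by_contra h
    rw [if_neg h] at this
    exact one_ne_zero this
  · intro h
    induction h with
    | irr h => exact ⟨_, (isBasisMonomial_iff _).2 h, rfl⟩
    | step X s t Y h₁ h₂ _ ih => rwa [ofCo_braid X Y h₁ h₂]

end TL

/-! ### Property P1 as the existence of one dismantling step. -/

namespace LabelledHeap

variable {P : Type u} {C : Concurrency P} {E : LabelledHeap C} {S : Set E.carrier}

theorem isMax_iff {x : E.carrier} : IsMax x ↔ E.MaxIn Set.univ x := by
  refine ⟨fun h => ⟨trivial, fun y _ hR => h.not_lt hR.lt⟩, fun h => ?_⟩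
  by_contra hx
  obtain ⟨y, hy⟩ := not_isMax_iff.1 hx
  obtain ⟨u, hu, -⟩ := exists_R_le_of_lt hy
  exact h.2 u trivial hu

theorem isMin_iff {x : E.carrier} : IsMin x ↔ E.MinIn Set.univ x := by
  refine ⟨fun h => ⟨trivial, fun y _ hR => h.not_lt hR.lt⟩, fun h => ?_⟩
  by_contra hx
  obtain ⟨y, hy⟩ := not_isMin_iff.1 hx
  obtain ⟨u, -, hu⟩ := exists_le_R_of_lt hy
  exact h.2 u trivial hu

theorem maxIn_subheap_iff (b : S) : (E.subheap S).MaxIn Set.univ b ↔ E.MaxIn S b.1 := by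
  constructor
  · exact fun h => ⟨b.2, fun y hy hR => h.2 ⟨y, hy⟩ trivial ((subheap_R b ⟨y, hy⟩).2 hR)⟩
  · exact fun h => ⟨trivial, fun y _ hR => h.2 y.1 y.2 ((subheap_R b y).1 hR)⟩

theorem minIn_subheap_iff (b : S) : (E.subheap S).MinIn Set.univ b ↔ E.MinIn S b.1 := by
  constructor
  · exact fun h => ⟨b.2, fun y hy hR => h.2 ⟨y, hy⟩ trivial ((subheap_R ⟨y, hy⟩ b).2 hR)⟩
  · exact fun h => ⟨trivial, fun y _ hR => h.2 y.1 y.2 ((subheap_R y b).1 hR)⟩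

theorem setOf_ne_eq (v : E.carrier) : {x | x ≠ v} = Set.univ \ {v} := by
  ext; simp

theorem delete_monomial (v : E.carrier) :
    (E.delete v).monomial = E.mon (Set.univ \ {v}) := by
  rw [delete, subheap_monomial, setOf_ne_eq]

theorem isTrivial_iff : E.IsTrivial ↔ ∀ x y, ¬ E.R x y := by
  constructor
  · exact fun h x y hR => hR.ne (h x y hR.lt.le)
  · intro h x y hxy
    by_contra hne
    obtain ⟨u, hu, -⟩ := exists_R_le_of_lt (lt_of_le_of_ne hxy hne)
    exact h _ _ hu

variable (E) in
/-- `a` is maximal in the subheap on `S`, and deleting `a` makes `b` maximal. -/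
structure ExposesMax (S : Set E.carrier) (a b : E.carrier) : Prop where
  max : E.MaxIn S a
  exposed : E.MaxIn (S \ {a}) b
  rel : E.R b a

variable (E) in
/-- `a` is minimal in the subheap on `S`, and deleting `a` makes `b` minimal. -/
structure ExposesMin (S : Set E.carrier) (a b : E.carrier) : Prop where
  min : E.MinIn S a
  exposed : E.MinIn (S \ {a}) b
  rel : E.R a b

theorem ExposesMax.mon_eq {a b : E.carrier} (h : E.ExposesMax S a b) :
    E.mon S = E.mon ((S \ {a}) \ {b}) * Co.gen C (E.label b) * Co.gen C (E.label a) := by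
  rw [h.max.mon_eq, h.exposed.mon_eq]

theorem ExposesMin.mon_eq {a b : E.carrier} (h : E.ExposesMin S a b) :
    E.mon S = Co.gen C (E.label a) * Co.gen C (E.label b) * E.mon ((S \ {a}) \ {b}) := by
  rw [h.min.mon_eq, h.exposed.mon_eq, mul_assoc]

theorem exists_exposesMax {X : Co C} {s t : P} (hne : s ≠ t) (hC : C.rel s t)
    (h : E.mon S = X * Co.gen C t * Co.gen C s) :
    ∃ a b, E.ExposesMax S a b ∧ E.label a = s ∧ E.label b = t := by
  obtain ⟨a, ha, rfl, e⟩ := exists_maxIn_of_mon_eq h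
  obtain ⟨b, hb, rfl, -⟩ := exists_maxIn_of_mon_eq e
  refine ⟨a, b, ⟨ha, hb, ?_⟩, rfl, rfl⟩
  exact (R_total (fun e => hne (congrArg E.label e)) hC).resolve_left (ha.2 b hb.1.1)

theorem exists_exposesMin {X : Co C} {s t : P} (hne : s ≠ t) (hC : C.rel s t)
    (h : E.mon S = Co.gen C s * Co.gen C t * X) :
    ∃ a b, E.ExposesMin S a b ∧ E.label a = s ∧ E.label b = t := by
  obtain ⟨a, ha, rfl, e⟩ := exists_minIn_of_mon_eq (Z := Co.gen C t * X) (by rw [h, mul_assoc])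
  obtain ⟨b, hb, rfl, -⟩ := exists_minIn_of_mon_eq e
  refine ⟨a, b, ⟨ha, hb, ?_⟩, rfl, rfl⟩
  exact (R_total (fun e => hne (congrArg E.label e)) hC).resolve_right (ha.2 b hb.1.1)

/-- With equal labels `b` and `a` would be a pair, since `b` has nothing above it but `a`. So under
P2 the label condition in `≺` is automatic. -/
theorem ExposesMax.label_ne {a b : E.carrier} (h : E.ExposesMax S a b)
    (hS : (E.mon S).IsIrr) : E.label a ≠ E.label b := by
  intro e
  refine (isIrr_mon_iff.1 hS).1 b a ⟨h.exposed.1.1, h.max.1, h.rel, e.symm, fun u hu h₁ h₂ => ?_⟩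
  exact h.exposed.2 u ⟨hu, h₂.ne⟩ h₁

theorem ExposesMin.label_ne {a b : E.carrier} (h : E.ExposesMin S a b)
    (hS : (E.mon S).IsIrr) : E.label a ≠ E.label b := by
  intro e
  refine (isIrr_mon_iff.1 hS).1 a b ⟨h.min.1, h.exposed.1.1, h.rel, e, fun u hu h₁ h₂ => ?_⟩
  exact h.exposed.2 u ⟨hu, h₁.ne.symm⟩ h₂

variable (E) in
/-- The subheap on `S` is trivial, or deleting some maximal (minimal) vertex exposes another. -/
def StarReducible (S : Set E.carrier) : Prop :=
  (∀ x ∈ S, ∀ y ∈ S, ¬ E.R x y) ∨ (∃ a b, E.ExposesMax S a b) ∨ ∃ a b, E.ExposesMin S a b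

theorem PrecPlus.exists_exposesMax {F : LabelledHeap C} (h : PrecPlus F E) :
    ∃ a b, F = E.delete a ∧ E.ExposesMax Set.univ a b := by
  obtain ⟨a, rfl, ha, b, hb, hb', -⟩ := h
  have hmax : E.MaxIn (Set.univ \ {a}) b.1 := by
    rw [← setOf_ne_eq]
    exact (maxIn_subheap_iff b).1 (isMax_iff.1 hb)
  refine ⟨a, b.1, rfl, isMax_iff.1 ha, hmax, ?_⟩
  by_contra hR
  refine hb' (isMax_iff.2 ⟨trivial, fun y _ hy => ?_⟩)
  by_cases hya : y = a
  · exact hR (hya ▸ hy)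
  · exact hmax.2 y ⟨trivial, hya⟩ hy

theorem PrecMinus.exists_exposesMin {F : LabelledHeap C} (h : PrecMinus F E) :
    ∃ a b, F = E.delete a ∧ E.ExposesMin Set.univ a b := by
  obtain ⟨a, rfl, ha, b, hb, hb', -⟩ := h
  have hmin : E.MinIn (Set.univ \ {a}) b.1 := by
    rw [← setOf_ne_eq]
    exact (minIn_subheap_iff b).1 (isMin_iff.1 hb)
  refine ⟨a, b.1, rfl, isMin_iff.1 ha, hmin, ?_⟩
  by_contra hR
  refine hb' (isMin_iff.2 ⟨trivial, fun y _ hy => ?_⟩)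
  by_cases hya : y = a
  · exact hR (hya ▸ hy)
  · exact hmin.2 y ⟨trivial, hya⟩ hy

theorem ExposesMax.prec {a b : E.carrier} (h : E.ExposesMax Set.univ a b) (hE : E.HasP2) :
    Prec (E.delete a) E := by
  refine .inl ⟨a, rfl, isMax_iff.2 h.max, ⟨b, h.rel.ne⟩, ?_, fun hb => hb.not_lt h.rel.lt,
    (h.label_ne (by rw [mon_univ]; exact hasP2_iff.1 hE)).symm⟩
  refine isMax_iff.2 ((maxIn_subheap_iff (E := E) (S := {x | x ≠ a}) ⟨b, h.rel.ne⟩).2 ?_)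
  exact ⟨h.rel.ne, fun y hy => h.exposed.2 y ⟨trivial, hy⟩⟩

theorem ExposesMin.prec {a b : E.carrier} (h : E.ExposesMin Set.univ a b) (hE : E.HasP2) :
    Prec (E.delete a) E := by
  refine .inr ⟨a, rfl, isMin_iff.2 h.min, ⟨b, h.rel.ne.symm⟩, ?_, fun hb => hb.not_lt h.rel.lt,
    (h.label_ne (by rw [mon_univ]; exact hasP2_iff.1 hE)).symm⟩
  refine isMin_iff.2 ((minIn_subheap_iff (E := E) (S := {x | x ≠ a}) ⟨b, h.rel.ne.symm⟩).2 ?_)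
  exact ⟨h.rel.ne.symm, fun y hy => h.exposed.2 y ⟨trivial, hy⟩⟩

theorem HasP2.delete_of_mon {a : E.carrier} (hE : E.HasP2) (h : (∃ s, E.mon Set.univ =
    E.mon (Set.univ \ {a}) * s) ∨ ∃ s, E.mon Set.univ = s * E.mon (Set.univ \ {a})) :
    (E.delete a).HasP2 := by
  rw [hasP2_iff, delete_monomial]
  rw [hasP2_iff, ← mon_univ] at hE
  rcases h with ⟨s, h⟩ | ⟨s, h⟩ <;> rw [h] at hE
  exacts [hE.of_mul_right, hE.of_mul_left]

/-- Property P1 for all heaps with property P2 means that each of these is trivial or can be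
reduced by one step. -/
theorem forall_hasP1_iff : (∀ E : LabelledHeap C, E.HasP2 → E.HasP1) ↔
    ∀ E : LabelledHeap C, E.HasP2 → E.StarReducible Set.univ := by
  constructor
  · intro h E hE
    obtain ⟨E₁, h₁, h₂⟩ := h E hE
    cases h₂ with
    | refl => exact .inl fun x _ y _ => isTrivial_iff.1 h₁ x y
    | tail _ hF =>
      rcases hF with hF | hF
      · obtain ⟨a, b, -, hab⟩ := hF.exists_exposesMax
        exact .inr (.inl ⟨a, b, hab⟩)
      · obtain ⟨a, b, -, hab⟩ := hF.exists_exposesMin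
        exact .inr (.inr ⟨a, b, hab⟩)
  · intro h E hE
    induction hn : Nat.card E.carrier using Nat.strong_induction_on generalizing E with
    | _ n ih =>
      subst hn
      have key : ∀ a, (E.delete a).HasP2 → Prec (E.delete a) E → E.HasP1 := by
        intro a hP hpr
        obtain ⟨E₁, h₁, h₂⟩ := ih _ (Finite.card_subtype_lt (p := (· ≠ a)) (x := a) (by simp))
          (E.delete a) hP rfl
        exact ⟨E₁, h₁, h₂.tail hpr⟩
      rcases h E hE with ht | ⟨a, b, hab⟩ | ⟨a, b, hab⟩
      · exact ⟨E, isTrivial_iff.2 fun x y => ht x trivial y trivial, .refl⟩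
      · exact key a (hE.delete_of_mon (.inl ⟨_, hab.max.mon_eq⟩)) (hab.prec hE)
      · exact key a (hE.delete_of_mon (.inr ⟨_, hab.min.mon_eq⟩)) (hab.prec hE)

theorem starReducible_subheap_iff :
    (E.subheap S).StarReducible Set.univ ↔ E.StarReducible S := by
  have hd : ∀ (a b : S), (E.subheap S).MaxIn (Set.univ \ {a}) b ↔ E.MaxIn (S \ {a.1}) b.1 := by
    intro a b
    constructor
    · intro h
      refine ⟨⟨b.2, fun e => h.1.2 (Subtype.ext e)⟩, fun y hy hR => ?_⟩
      exact h.2 ⟨y, hy.1⟩ ⟨trivial, fun e => hy.2 (congrArg Subtype.val e)⟩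
        ((subheap_R b ⟨y, hy.1⟩).2 hR)
    · intro h
      refine ⟨⟨trivial, fun e => h.1.2 (congrArg Subtype.val e)⟩, fun y hy hR => ?_⟩
      exact h.2 y.1 ⟨y.2, fun e => hy.2 (Subtype.ext e)⟩ ((subheap_R b y).1 hR)
  have hd' : ∀ (a b : S), (E.subheap S).MinIn (Set.univ \ {a}) b ↔ E.MinIn (S \ {a.1}) b.1 := by
    intro a b
    constructor
    · intro h
      refine ⟨⟨b.2, fun e => h.1.2 (Subtype.ext e)⟩, fun y hy hR => ?_⟩
      exact h.2 ⟨y, hy.1⟩ ⟨trivial, fun e => hy.2 (congrArg Subtype.val e)⟩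
        ((subheap_R ⟨y, hy.1⟩ b).2 hR)
    · intro h
      refine ⟨⟨trivial, fun e => h.1.2 (congrArg Subtype.val e)⟩, fun y hy hR => ?_⟩
      exact h.2 y.1 ⟨y.2, fun e => hy.2 (Subtype.ext e)⟩ ((subheap_R y b).1 hR)
  refine or_congr ?_ (or_congr ?_ ?_)
  · constructor
    · exact fun h x hx y hy hR => h ⟨x, hx⟩ trivial ⟨y, hy⟩ trivial ((subheap_R ⟨x, hx⟩ ⟨y, hy⟩).2 hR)
    · exact fun h x _ y _ hR => h x.1 x.2 y.1 y.2 ((subheap_R x y).1 hR)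
  · constructor
    · rintro ⟨a, b, h₁, h₂, h₃⟩
      exact ⟨a.1, b.1, (maxIn_subheap_iff a).1 h₁, (hd a b).1 h₂, (subheap_R b a).1 h₃⟩
    · rintro ⟨a, b, h₁, h₂, h₃⟩
      exact ⟨⟨a, h₁.1⟩, ⟨b, h₂.1.1⟩, (maxIn_subheap_iff ⟨a, h₁.1⟩).2 h₁,
        (hd ⟨a, h₁.1⟩ ⟨b, h₂.1.1⟩).2 h₂, (subheap_R ⟨b, h₂.1.1⟩ ⟨a, h₁.1⟩).2 h₃⟩
  · constructor
    · rintro ⟨a, b, h₁, h₂, h₃⟩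
      exact ⟨a.1, b.1, (minIn_subheap_iff a).1 h₁, (hd' a b).1 h₂, (subheap_R a b).1 h₃⟩
    · rintro ⟨a, b, h₁, h₂, h₃⟩
      exact ⟨⟨a, h₁.1⟩, ⟨b, h₂.1.1⟩, (minIn_subheap_iff ⟨a, h₁.1⟩).2 h₁,
        (hd' ⟨a, h₁.1⟩ ⟨b, h₂.1.1⟩).2 h₂, (subheap_R ⟨a, h₁.1⟩ ⟨b, h₂.1.1⟩).2 h₃⟩

theorem starReducible_of_forall (h : ∀ E : LabelledHeap C, E.HasP2 → E.StarReducible Set.univ)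
    (hS : (E.mon S).IsIrr) : E.StarReducible S :=
  starReducible_subheap_iff.1 (h (E.subheap S) (hasP2_iff.2 (by rwa [subheap_monomial])))

end LabelledHeap

/-! ### From dismantling steps to deletion of letters. -/

namespace LabelledHeap

variable {P : Type u} {C : Concurrency P} {E : LabelledHeap C} {S : Set E.carrier}

theorem MaxIn.sdiff {a v : E.carrier} (h : E.MaxIn S a) (hv : a ≠ v) : E.MaxIn (S \ {v}) a :=
  ⟨⟨h.1, hv⟩, fun y hy => h.2 y hy.1⟩

/-- Appending a maximal vertex to a heap with property P2. -/
theorem MaxIn.reducible {a : E.carrier} (ha : E.MaxIn S a) (hirr : (E.mon (S \ {a})).IsIrr)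
    (hdel : ∀ y ∈ S \ {a}, (E.mon ((S \ {a}) \ {y})).Reducible) (hp : ∀ x, ¬ IsPair S x a) :
    (E.mon S).Reducible := by
  by_cases h : (E.mon S).IsIrr
  · exact .irr h
  have hcon := isIrr_mon_iff.1 hirr
  have hne : ∀ {x y}, y ∈ S → E.R x y → x ≠ a := by
    rintro x y hy hR rfl
    exact ha.2 y hy hR
  simp only [isIrr_mon_iff, not_and_or, not_forall, not_not] at h
  rcases h with ⟨x, y, h⟩ | ⟨x, y, z, h⟩
  · by_cases hy : y = a
    · exact absurd (hy ▸ h) (hp x)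
    · exact absurd (h.mono Set.sdiff_subset ⟨h.left, hne h.right h.rel⟩ ⟨h.right, hy⟩) (hcon.1 x y)
  · have hya := hne h.right h.rel_right
    -- A triple that was not there before ends at `a`. Its contraction removes `y` and `a`, which
    -- leaves a deletion covered by `hdel`.
    by_cases hz : z = a
    · subst hz
      refine h.reducible ?_
      rw [sdiff_pair_eq']
      exact hdel y ⟨h.mid, hya⟩
    · exact absurd (h.mono Set.sdiff_subset ⟨h.left, hne h.right h.rel⟩ ⟨h.mid, hya⟩ ⟨h.right, hz⟩)
        (hcon.2 x y z)

end LabelledHeap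

namespace Co

variable {P : Type u} {C : Concurrency P}

/-- Deleting a letter of `m` gives a reducible monomial. -/
def DeletesReducibly (m : Co C) : Prop := ∀ X Y p, m = X * gen C p * Y → (X * Y).Reducible

theorem DeletesReducibly.mon_sdiff {E : LabelledHeap C} {S : Set E.carrier}
    (h : (E.mon S).DeletesReducibly) {v : E.carrier} (hv : v ∈ S) :
    (E.mon (S \ {v})).Reducible := by
  obtain ⟨X, Y, e₁, e₂⟩ := LabelledHeap.exists_mon_eq_of_mem hv
  rw [e₂]
  exact h _ _ _ e₁

theorem DeletesReducibly.of_rev {m : Co C} (h : m.rev.DeletesReducibly) :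
    m.DeletesReducibly := by
  intro X Y p e
  have := (h Y.rev X.rev p (by simp [e, mul_assoc])).rev
  simpa using this

/-- Induction on the reduction of `m`, performed so that a final `t` persists. At the irreducible
end, that `t` separates the appended `s` from every earlier `s`, so no square arises and only
triples ending in the new letter must be contracted. -/
theorem Reducible.mul_gen {m : Co C} (h : m.Reducible) {s t : P} (hne : s ≠ t) (hC : C.rel s t)
    (ih : ∀ g : Co C, g.IsIrr → g.len ≤ m.len → g.DeletesReducibly) :
    (∃ Q, m = Q * gen C t) → (m * gen C s).Reducible := by
  induction h with
  | @irr g hg =>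
    rintro ⟨Q, hQ⟩
    obtain ⟨F, hF⟩ := LabelledHeap.exists_monomial_eq (g * gen C s)
    rw [← LabelledHeap.mon_univ] at hF
    obtain ⟨a, ha, rfl, ea⟩ := LabelledHeap.exists_maxIn_of_mon_eq hF
    obtain ⟨b, hb, rfl, -⟩ := LabelledHeap.exists_maxIn_of_mon_eq (ea.trans hQ)
    rw [← hF]
    refine ha.reducible (ea.symm ▸ hg) (fun y hy => ?_) fun x hx => ?_
    · exact DeletesReducibly.mon_sdiff (by rw [ea]; exact ih g hg le_rfl) hy
    · have hba : F.R b a := (LabelledHeap.R_total (fun e => hne (congrArg F.label e)) hC).resolve_left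
        (ha.2 b trivial)
      have hxb : x ≠ b := fun e => hne (by rw [← e, hx.label_eq])
      rcases LabelledHeap.R_total hxb (hx.label_eq ▸ hC) with hR | hR
      · exact hx.between b trivial hR hba
      · exact hb.2 x ⟨trivial, hx.rel.ne⟩ hR
  | step X p q Y hpq hCpq _ ih' =>
    rintro ⟨Q, hQ⟩
    -- The final vertex `b` is neither `x` nor `y`, since each of these has a vertex of the triple
    -- above it. Contracting by removing `x` and `y` therefore keeps it.
    have h₁ : ∃ Q', X * gen C p * Y = Q' * gen C t := by
      obtain ⟨F, hF⟩ := LabelledHeap.exists_monomial_eq (X * gen C p * gen C q * gen C p * Y)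
      rw [← LabelledHeap.mon_univ] at hF
      obtain ⟨x, y, z, h, e⟩ := LabelledHeap.exists_isTrip_of_mon_eq hpq hCpq hF
      obtain ⟨b, hb, rfl, -⟩ := LabelledHeap.exists_maxIn_of_mon_eq (hF.trans hQ)
      have hbx : b ≠ x := by rintro rfl; exact hb.2 y trivial h.rel_left
      have hby : b ≠ y := by rintro rfl; exact hb.2 z trivial h.rel_right
      rw [← e, ← h.mon_eq, LabelledHeap.sdiff_pair_eq]
      exact ⟨_, ((hb.sdiff hbx).sdiff hby).mon_eq⟩
    have h₂ := ih' (fun g hg hl => ih g hg (hl.trans (by simp only [len_mul]; lia))) h₁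
    have := Reducible.step X p q (Y * gen C s) hpq hCpq (by simpa only [mul_assoc] using h₂)
    simpa only [mul_assoc] using this

/-- If the deleted vertex is `a`, the rest is irreducible. If it is the exposed `b`, then `a` is
appended to the irreducible heap without `a` and `b`. Otherwise the vertex is deleted from the heap
without `a` by induction, and `a` is put back through `Reducible.mul_gen`. -/
theorem IsIrr.deletesReducibly_of_exposes {m Z : Co C} (hm : m.IsIrr) {s t : P} (hne : s ≠ t)
    (hC : C.rel s t) (e : m = Z * gen C t * gen C s)
    (ih : ∀ g : Co C, g.IsIrr → g.len < m.len → g.DeletesReducibly) : m.DeletesReducibly := by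
  intro X Y p e'
  obtain ⟨E, rfl⟩ := LabelledHeap.exists_monomial_eq m
  rw [← LabelledHeap.mon_univ] at e e' ih hm
  obtain ⟨a, b, hab, rfl, rfl⟩ := LabelledHeap.exists_exposesMax hne hC e
  obtain ⟨v, -, -, ev⟩ := LabelledHeap.exists_mem_of_mon_eq e'
  rw [← ev]
  have hlen₁ : (E.mon (Set.univ \ {a})).len < (E.mon Set.univ).len := by
    rw [hab.max.mon_eq]; simp
  have hlen₂ : (E.mon ((Set.univ \ {a}) \ {b})).len < (E.mon (Set.univ \ {a})).len := by
    rw [hab.exposed.mon_eq]; simp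
  have hirr₁ : (E.mon (Set.univ \ {a})).IsIrr := by
    rw [hab.max.mon_eq] at hm; exact hm.of_mul_right
  have hirr₂ : (E.mon ((Set.univ \ {a}) \ {b})).IsIrr := by
    rw [hab.exposed.mon_eq] at hirr₁; exact hirr₁.of_mul_right
  by_cases hva : v = a
  · subst hva
    exact .irr hirr₁
  by_cases hvb : v = b
  · subst hvb
    refine (hab.max.sdiff (Ne.symm hva)).reducible ?_ (fun y hy => ?_) fun x hx => ?_
    · rwa [sdiff_right_comm]
    · refine DeletesReducibly.mon_sdiff ?_ hy
      rw [sdiff_right_comm]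
      exact ih _ hirr₂ (hlen₂.trans hlen₁)
    -- Two vertices lay between `x` and `a` before the deletion, and at most one of them was
    -- deleted.
    · obtain ⟨u, -, w, -, huw, h₁, h₂, h₃, h₄⟩ := LabelledHeap.twoBetween_iff.2 hm x trivial a trivial
        hx.rel hx.label_eq
      by_cases hu : u = v
      · exact hx.between w ⟨trivial, fun hw => huw (hu.trans hw.symm)⟩ h₃ h₄
      · exact hx.between u ⟨trivial, hu⟩ h₁ h₂
  · rw [(hab.max.sdiff (Ne.symm hva)).mon_eq, sdiff_right_comm]
    have hred : (E.mon ((Set.univ \ {a}) \ {v})).Reducible :=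
      DeletesReducibly.mon_sdiff (ih _ hirr₁ hlen₁) ⟨trivial, hva⟩
    refine hred.mul_gen hne hC (fun g hg hl => ih g hg (hl.trans_lt ?_))
      ⟨_, (hab.exposed.sdiff (Ne.symm hvb)).mon_eq⟩
    obtain ⟨X, Y, e₁, e₂⟩ := LabelledHeap.exists_mon_eq_of_mem
      (S := Set.univ \ {a}) (x := v) ⟨trivial, hva⟩
    rw [e₁] at hlen₁
    rw [e₂]
    simp only [len_mul] at hlen₁ ⊢
    lia

theorem IsIrr.deletesReducibly
    (h : ∀ E : LabelledHeap C, E.HasP2 → E.StarReducible Set.univ) {m : Co C} (hm : m.IsIrr) :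
    m.DeletesReducibly := by
  induction hn : m.len using Nat.strong_induction_on generalizing m with
  | _ n ih =>
    subst hn
    obtain ⟨E, rfl⟩ := LabelledHeap.exists_monomial_eq m
    have hm' : (E.mon Set.univ).IsIrr := by rwa [LabelledHeap.mon_univ]
    rcases h E (LabelledHeap.hasP2_iff.2 hm) with ht | ⟨a, b, hab⟩ | ⟨a, b, hab⟩
    · intro X Y p e
      rw [← LabelledHeap.mon_univ] at e
      obtain ⟨v, -, -, ev⟩ := LabelledHeap.exists_mem_of_mon_eq e
      rw [← ev]
      exact .irr (LabelledHeap.TwoBetween.isIrr fun x _ z _ hR =>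
        absurd hR (ht x trivial z trivial))
    · exact hm.deletesReducibly_of_exposes (hab.label_ne hm') (C.symm _ _ hab.rel.rel)
        (by rw [← LabelledHeap.mon_univ]; exact hab.mon_eq) fun g hg hl => ih _ hl hg rfl
    · refine DeletesReducibly.of_rev (hm.rev.deletesReducibly_of_exposes
        (Z := (E.mon ((Set.univ \ {a}) \ {b})).rev) (hab.label_ne hm') hab.rel.rel ?_
        fun g hg hl => ih _ (by simpa using hl) hg rfl)
      rw [← LabelledHeap.mon_univ, hab.mon_eq]
      simp [mul_assoc]

end Co

/-! ### From deletion of letters to dismantling steps: the doubled heap. -/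

namespace LabelledHeap

variable {P : Type u} {C : Concurrency P} (E : LabelledHeap C)

/-- The opposite heap. -/
def op : LabelledHeap C where
  carrier := E.carrier
  finite := E.finite
  order := (inferInstance : PartialOrder E.carrierᵒᵈ)
  label := E.label
  comparable := fun a b h => (E.comparable a b h).symm
  le_iff := fun a b => by
    refine (E.le_iff b a).trans ?_
    rw [← Relation.transGen_swap]
    constructor <;> intro h <;>
      exact Relation.TransGen.mono (fun x y hxy => ⟨hxy.1, C.symm _ _ hxy.2⟩) _ _ h

theorem op_R (x y : E.carrier) : E.op.R x y ↔ E.R y x :=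
  and_congr Iff.rfl ⟨C.symm _ _, C.symm _ _⟩

theorem op_maxIn (S : Set E.carrier) (x : E.carrier) : E.op.MaxIn S x ↔ E.MinIn S x :=
  and_congr Iff.rfl (forall₂_congr fun y _ => not_congr (op_R E x y))

theorem op_minIn (S : Set E.carrier) (x : E.carrier) : E.op.MinIn S x ↔ E.MaxIn S x :=
  and_congr Iff.rfl (forall₂_congr fun y _ => not_congr (op_R E y x))

theorem op_exposesMax (S : Set E.carrier) (a b : E.carrier) :
    E.op.ExposesMax S a b ↔ E.ExposesMin S a b :=
  ⟨fun h => ⟨(op_maxIn E S a).1 h.max, (op_maxIn E (S \ {a}) b).1 h.exposed, (op_R E b a).1 h.rel⟩,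
    fun h => ⟨(op_maxIn E S a).2 h.min, (op_maxIn E (S \ {a}) b).2 h.exposed, (op_R E b a).2 h.rel⟩⟩

theorem op_exposesMin (S : Set E.carrier) (a b : E.carrier) :
    E.op.ExposesMin S a b ↔ E.ExposesMax S a b :=
  ⟨fun h => ⟨(op_minIn E S a).1 h.min, (op_minIn E (S \ {a}) b).1 h.exposed, (op_R E a b).1 h.rel⟩,
    fun h => ⟨(op_minIn E S a).2 h.max, (op_minIn E (S \ {a}) b).2 h.exposed, (op_R E a b).2 h.rel⟩⟩

theorem op_starReducible (S : Set E.carrier) (h : E.StarReducible S) : E.op.StarReducible S := by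
  rcases h with h | ⟨a, b, h⟩ | ⟨a, b, h⟩
  · exact .inl fun x hx y hy hR => h y hy x hx ((op_R E x y).1 hR)
  · exact .inr (.inr ⟨a, b, (op_exposesMin E S a b).2 h⟩)
  · exact .inr (.inl ⟨a, b, (op_exposesMax E S a b).2 h⟩)

theorem op_twoBetween (S : Set E.carrier) : E.op.TwoBetween S ↔ E.TwoBetween S := by
  constructor
  · intro h x hx z hz hR hl
    obtain ⟨u, hu, w, hw, hne, h₁, h₂, h₃, h₄⟩ := h z hz x hx ((op_R E z x).2 hR) hl.symm
    exact ⟨u, hu, w, hw, hne, (op_R E u x).1 h₂, (op_R E z u).1 h₁, (op_R E w x).1 h₄,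
      (op_R E z w).1 h₃⟩
  · intro h x hx z hz hR hl
    obtain ⟨u, hu, w, hw, hne, h₁, h₂, h₃, h₄⟩ := h z hz x hx ((op_R E x z).1 hR) hl.symm
    exact ⟨u, hu, w, hw, hne, (op_R E x u).2 h₂, (op_R E u z).2 h₁, (op_R E x w).2 h₄,
      (op_R E w z).2 h₃⟩

variable {E} {S : Set E.carrier}

variable (E) in
-- Positions in a listing, together with labels, determine `R`. The doubled heap is built by
-- reflecting these positions.
theorem exists_pos : ∃ (pos : E.carrier → ℕ) (n : ℕ), Function.Injective pos ∧ (∀ x, pos x < n) ∧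
    ∀ x y, E.R x y ↔ pos x < pos y ∧ C.rel (E.label x) (E.label y) := by
  classical
  obtain ⟨l, hl⟩ := E.exists_isListing Set.univ
  have hm : ∀ x, l.idxOf x < l.length := fun x => List.idxOf_lt_length_iff.2 ((hl.mem x).2 trivial)
  have hg : ∀ x, l[l.idxOf x]'(hm x) = x := fun x => List.getElem_idxOf (hm x)
  have hinj : Function.Injective fun x => l.idxOf x := by
    intro x y hxy
    have h₁ := hg x
    have h₂ := hg y
    simp only at hxy
    simp only [hxy] at h₁
    rw [← h₁, h₂]
  have hlt : ∀ x y, E.R x y → l.idxOf x < l.idxOf y := by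
    intro x y hR
    by_contra hcon
    rcases (not_lt.1 hcon).lt_or_eq with h | h
    · have := List.pairwise_iff_getElem.1 hl.pairwise _ _ (hm y) (hm x) h
      rw [hg, hg] at this
      exact this hR
    · exact hR.ne (hinj h.symm)
  refine ⟨fun x => l.idxOf x, l.length, hinj, hm, fun x y => ⟨fun h => ⟨hlt x y h, h.rel⟩, ?_⟩⟩
  rintro ⟨h, hC⟩
  exact (R_total (fun e => by simp [e] at h) hC).resolve_right fun hR => h.asymm (hlt y x hR)

variable (E) in
/-- The maximal vertices of the subheap on `S`. -/
def maxs (S : Set E.carrier) : Set E.carrier := {x | E.MaxIn S x}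

variable (E) in
/-- The monomial of the subheap on `S` followed by its mirror image, the maximal vertices not being
repeated. -/
noncomputable def double (S : Set E.carrier) : Co C := E.mon S * (E.mon (S \ E.maxs S)).rev

theorem exists_last (x : E.carrier) : ∃ p, E.label p = E.label x ∧
    ∀ q, E.label q = E.label x → q = p ∨ E.R q p := by
  obtain ⟨p, hp⟩ := (Set.toFinite {q | E.label q = E.label x}).exists_maximal ⟨x, rfl⟩
  refine ⟨p, hp.1, fun q hq => ?_⟩
  by_cases hqp : q = p
  · exact .inl hqp
  · refine .inr ((R_total hqp (hq.trans hp.1.symm ▸ C.refl _)).resolve_right fun hR => ?_)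
    exact hp.not_gt hq hR.lt

/-- The double is realized on two copies of the vertices, the second one reversed and without the
maximal vertices. Only equal labels on opposite sides of the fold need care, and there the absence
of an exposing maximal vertex supplies the second vertex in between. -/
theorem double_univ_isIrr (hE : E.TwoBetween Set.univ)
    (hmax : ∀ a b, ¬ E.ExposesMax Set.univ a b) : (E.double Set.univ).IsIrr := by
  obtain ⟨pos, n, hinj, hn, hpos⟩ := E.exists_pos
  -- All `pos x` are less than `n`, so the reflected positions exceed `n` and the second copy comes
  -- entirely after the first.
  let pos' : E.carrier ⊕ E.carrier → ℕ := Sum.elim pos fun x => 2 * n - pos x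
  have hinj' : Function.Injective pos' := by
    rintro (x | x) (y | y) hxy
    · exact congrArg _ (hinj hxy)
    · have h₁ := hn x; have h₂ := hn y
      simp only [pos', Sum.elim_inl, Sum.elim_inr] at hxy
      lia
    · have h₁ := hn x; have h₂ := hn y
      simp only [pos', Sum.elim_inl, Sum.elim_inr] at hxy
      lia
    · have h₁ := hn x; have h₂ := hn y
      simp only [pos', Sum.elim_inr] at hxy
      exact congrArg _ (hinj (by lia))
  let D := ofPos C (E.carrier ⊕ E.carrier) (Sum.elim E.label E.label) pos' hinj'
  have hll : ∀ x y, D.R (Sum.inl x) (Sum.inl y) ↔ E.R x y := fun x y =>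
    (ofPos_R _ _).trans (hpos x y).symm
  have hrr : ∀ x y, D.R (Sum.inr x) (Sum.inr y) ↔ E.R y x := fun x y => by
    refine (ofPos_R _ _).trans (Iff.trans ?_ (hpos y x).symm)
    have h₁ := hn x; have h₂ := hn y
    refine and_congr ?_ ⟨C.symm _ _, C.symm _ _⟩
    simp only [pos', Sum.elim_inr]
    lia
  have hlr : ∀ x y, C.rel (E.label x) (E.label y) → D.R (Sum.inl x) (Sum.inr y) := fun x y hC => by
    refine (ofPos_R _ _).2 ⟨?_, hC⟩
    have h₁ := hn x; have h₂ := hn y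
    simp only [pos', Sum.elim_inl, Sum.elim_inr]
    lia
  have hrl : ∀ x y, ¬ D.R (Sum.inr x) (Sum.inl y) := fun x y hR => by
    have := ((ofPos_R _ _).1 hR).1
    have h₁ := hn x; have h₂ := hn y
    simp only [pos', Sum.elim_inl, Sum.elim_inr] at this
    lia
  let T : Set (E.carrier ⊕ E.carrier) := {p | ∀ x, p = Sum.inr x → x ∉ E.maxs Set.univ}
  have hTl : ∀ x, Sum.inl x ∈ T := fun x y h => by cases h
  have hTr : ∀ x, Sum.inr x ∈ T ↔ x ∉ E.maxs Set.univ := fun x =>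
    ⟨fun h => h x rfl, fun h y e => by rwa [← Sum.inr.inj e]⟩
  have hmon : D.mon T = E.double Set.univ := by
    obtain ⟨l, hl⟩ := E.exists_isListing Set.univ
    obtain ⟨l', hl'⟩ := E.exists_isListing (Set.univ \ E.maxs Set.univ)
    have h : D.IsListing T ((l.map Sum.inl ++ l'.reverse.map Sum.inr : List (E.carrier ⊕ E.carrier))) := by
      refine ⟨?_, ?_, ?_⟩
      · refine List.nodup_append.2 ⟨hl.nodup.map Sum.inl_injective,
          (List.nodup_reverse.2 hl'.nodup).map Sum.inr_injective, ?_⟩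
        intro a ha b hb
        obtain ⟨x, -, rfl⟩ := List.mem_map.1 ha
        obtain ⟨y, -, rfl⟩ := List.mem_map.1 hb
        exact Sum.inl_ne_inr
      · rintro (x | x)
        · exact ⟨fun _ => hTl x, fun _ => List.mem_append_left _
            (List.mem_map_of_mem ((hl.mem x).2 trivial))⟩
        · refine Iff.trans ?_ (hTr x).symm
          refine Iff.trans ?_ ((hl'.mem x).trans (by simp))
          refine List.mem_append.trans ⟨?_, fun h => .inr (List.mem_map_of_mem (by simpa using h))⟩
          rintro (h | h)
          · obtain ⟨y, -, hy⟩ := List.mem_map.1 h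
            exact absurd hy Sum.inl_ne_inr
          · obtain ⟨y, hy, e⟩ := List.mem_map.1 h
            rw [← Sum.inr.inj e]
            simpa using hy
      · refine List.pairwise_append.2 ⟨?_, ?_, ?_⟩
        · exact List.pairwise_map.2 (hl.pairwise.imp fun h h' => h ((hll _ _).1 h'))
        · refine List.pairwise_map.2 (List.pairwise_reverse.2 (hl'.pairwise.imp fun h h' => h ?_))
          exact (hrr _ _).1 h'
        · intro a ha b hb
          obtain ⟨x, -, rfl⟩ := List.mem_map.1 ha
          obtain ⟨y, -, rfl⟩ := List.mem_map.1 hb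
          exact hrl _ _
    have h₁ : List.map D.label (l.map Sum.inl ++ l'.reverse.map Sum.inr : List (E.carrier ⊕ E.carrier))
        = l.map E.label ++ (l'.map E.label).reverse := by
      refine (List.map_append (f := Sum.elim E.label E.label)).trans ?_
      rw [List.map_map, List.map_map, ← List.map_reverse]
      rfl
    rw [h.mon_eq, double, hl.mon_eq, hl'.mon_eq, Co.rev_word, h₁, Co.word_append]
  rw [← hmon]
  refine TwoBetween.isIrr ?_
  rintro (x | x) hx (z | z) hz hR hl
  · obtain ⟨u, -, w, -, hne, h₁, h₂, h₃, h₄⟩ := hE x trivial z trivial ((hll x z).1 hR) hl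
    exact ⟨Sum.inl u, hTl u, Sum.inl w, hTl w, fun e => hne (Sum.inl.inj e), (hll _ _).2 h₁,
      (hll _ _).2 h₂, (hll _ _).2 h₃, (hll _ _).2 h₄⟩
  · have hl : E.label x = E.label z := hl
    have hz : z ∉ E.maxs Set.univ := (hTr z).1 hz
    by_cases hxm : x ∈ E.maxs Set.univ
    -- Here `x` lies on the fold, so the vertices between `z` and `x` are used through their mirror
    -- images.
    · have hzx : E.R z x := (R_total (fun e : z = x => hz (e ▸ hxm)) (hl ▸ C.refl _)).resolve_right
        (hxm.2 z trivial)
      obtain ⟨u, -, w, -, hne, h₁, h₂, h₃, h₄⟩ := hE z trivial x trivial hzx hl.symm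
      refine ⟨Sum.inr u, (hTr u).2 fun h => h.2 x trivial h₂, Sum.inr w,
        (hTr w).2 fun h => h.2 x trivial h₄, fun e => hne (Sum.inr.inj e), hlr _ _ ?_,
        (hrr _ _).2 h₁, hlr _ _ ?_, (hrr _ _).2 h₃⟩
      exacts [C.symm _ _ h₂.rel, C.symm _ _ h₄.rel]
    -- Let `p` be the last vertex with this label. If `p` is maximal, two vertices between `x` and
    -- `p` serve. Otherwise everything related above `p` is related above `x` and `z`: a non-maximal
    -- such vertex serves twice, with its mirror image, and a maximal one is accompanied by another,
    -- since it would expose `p` if it were alone.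
    obtain ⟨p, hp, hlast⟩ := E.exists_last x
    by_cases hpm : p ∈ E.maxs Set.univ
    · have hxp : E.R x p := (hlast x rfl).resolve_left fun e => hxm (e ▸ hpm)
      obtain ⟨u, -, w, -, hne, h₁, h₂, h₃, h₄⟩ := hE x trivial p trivial hxp hp.symm
      refine ⟨Sum.inl u, hTl u, Sum.inl w, hTl w, fun e => hne (Sum.inl.inj e), (hll _ _).2 h₁,
        hlr _ _ ?_, (hll _ _).2 h₃, hlr _ _ ?_⟩
      exacts [hl ▸ C.symm _ _ h₁.rel, hl ▸ C.symm _ _ h₃.rel]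
    have hup : ∀ y, E.R p y → E.R x y ∧ E.R z y := by
      have key : ∀ q y, E.label q = E.label x → E.R p y → E.R q y := by
        intro q y hq hy
        rcases hlast q hq with rfl | hqp
        · exact hy
        · exact hqp.trans_of_eq hy (.inl (hq.trans hp.symm))
      exact fun y hy => ⟨key x y rfl hy, key z y hl.symm hy⟩
    have hbet : ∀ y, E.R p y → D.R (Sum.inl x) (Sum.inl y) ∧ D.R (Sum.inl y) (Sum.inr z) :=
      fun y hy => ⟨(hll _ _).2 (hup y hy).1, hlr _ _ (C.symm _ _ (hup y hy).2.rel)⟩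
    obtain ⟨y, hy⟩ : ∃ y, E.R p y := by
      by_contra hcon
      exact hpm ⟨trivial, fun y _ hy => hcon ⟨y, hy⟩⟩
    by_cases hym : y ∈ E.maxs Set.univ
    · obtain ⟨y', hy', hne⟩ : ∃ y', E.R p y' ∧ y' ≠ y := by
        by_contra hcon
        push Not at hcon
        exact hmax y p ⟨hym, ⟨⟨trivial, hy.ne⟩, fun y' h h' => h.2 (hcon y' h')⟩, hy⟩
      exact ⟨Sum.inl y, hTl y, Sum.inl y', hTl y', fun e => hne (Sum.inl.inj e).symm,
        (hbet y hy).1, (hbet y hy).2, (hbet y' hy').1, (hbet y' hy').2⟩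
    · exact ⟨Sum.inl y, hTl y, Sum.inr y, (hTr y).2 hym, Sum.inl_ne_inr, (hbet y hy).1, (hbet y hy).2,
        hlr _ _ (hup y hy).1.rel, (hrr _ _).2 (hup y hy).2⟩
  · exact absurd hR (hrl _ _)
  · obtain ⟨u, -, w, -, hne, h₁, h₂, h₃, h₄⟩ := hE z trivial x trivial ((hrr x z).1 hR) hl.symm
    exact ⟨Sum.inr u, (hTr u).2 fun h => h.2 x trivial h₂, Sum.inr w,
      (hTr w).2 fun h => h.2 x trivial h₄, fun e => hne (Sum.inr.inj e), (hrr _ _).2 h₂,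
      (hrr _ _).2 h₁, (hrr _ _).2 h₄, (hrr _ _).2 h₃⟩

/-- Peels `U` down from the top. Each removal contracts one factor `b a b` at the fold of `double U`
and preserves the number of maximal vertices, until the minimal vertices of `E` remain. -/
theorem ncard_maxs_eq (hE : E.TwoBetween Set.univ)
    (hmin : ∀ a b, ¬ E.ExposesMin Set.univ a b)
    (hsub : ∀ S : Set E.carrier, S ≠ Set.univ → E.TwoBetween S → E.StarReducible S)
    (U : Set E.carrier) (hlow : ∀ x ∈ U, ∀ y, E.R y x → y ∈ U)
    (hmins : {x | E.MinIn Set.univ x} ⊆ U) (hU : U ≠ Set.univ) (hred : (E.double U).Reducible) :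
    (E.maxs U).ncard = {x | E.MinIn Set.univ x}.ncard := by
  induction hn : U.ncard using Nat.strong_induction_on generalizing U with
  | _ n ih =>
    subst hn
    have htwo : E.TwoBetween U := by
      intro x hx z hz hR hl
      obtain ⟨u, -, w, -, hne, h₁, h₂, h₃, h₄⟩ := hE x trivial z trivial hR hl
      exact ⟨u, hlow z hz u h₂, w, hlow z hz w h₄, hne, h₁, h₂, h₃, h₄⟩
    rcases hsub U hU htwo with ht | ⟨a, b, hab⟩ | ⟨a, b, hab⟩
    · congr 1
      ext x
      exact ⟨fun hx => ⟨trivial, fun y _ hR => ht y (hlow x hx.1 y hR) x hx.1 hR⟩,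
        fun hx => ⟨hmins hx, fun y hy => ht x (hmins hx) y hy⟩⟩
    · have hW : ∀ b, E.ExposesMax U a b → E.MaxIn (U \ E.maxs U) b := fun b hb =>
        ⟨⟨hb.exposed.1.1, fun h => h.2 a hb.max.1 hb.rel⟩, fun y hy hR =>
          hb.exposed.2 y ⟨hy.1, fun e => hy.2 (e ▸ hb.max)⟩ hR⟩
      -- The first half ends in `b a` and the mirrored half begins with `b`; contracting `b a b` to
      -- `b` removes `a` and the mirrored `b`.
      have hred' : (E.mon (U \ {a}) * (E.mon ((U \ E.maxs U) \ {b})).rev).Reducible := by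
        rw [double, hab.mon_eq, (hW b hab).mon_eq] at hred
        rw [hab.exposed.mon_eq]
        refine (Co.reducible_braid_iff _ _ (hab.label_ne htwo.isIrr).symm hab.rel.rel).1 ?_
        simpa only [Co.rev_mul, Co.rev_gen, mul_assoc] using hred
      -- A second exposed vertex would still stand on both sides of the fold, making a square in a
      -- reducible monomial.
      have huniq : ∀ b', E.ExposesMax U a b' → b' = b := by
        intro b' hb'
        by_contra hne
        rw [hb'.exposed.mon_eq, ((hW b' hb').sdiff hne).mon_eq, Co.rev_mul, Co.rev_gen,
          ← mul_assoc] at hred'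
        exact Co.not_reducible_of_sq _ _ _ hred'
      have hmx : ∀ x, E.MaxIn (U \ {a}) x ↔ (E.MaxIn U x ∧ x ≠ a) ∨ x = b := by
        intro x
        constructor
        · intro hx
          by_cases hxm : E.MaxIn U x
          · exact .inl ⟨hxm, hx.1.2⟩
          · refine .inr (huniq x ⟨hab.max, hx, ?_⟩)
            by_contra hR
            exact hxm ⟨hx.1.1, fun y hy h =>
              hx.2 y ⟨hy, fun e : y = a => hR (e ▸ h)⟩ h⟩
        · rintro (⟨hx, hne⟩ | rfl)
          · exact hx.sdiff hne
          · exact hab.exposed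
      have hbm : b ∉ E.maxs U := fun h => h.2 a hab.max.1 hab.rel
      have hcard : (E.maxs (U \ {a})).ncard = (E.maxs U).ncard := by
        have : E.maxs (U \ {a}) = insert b (E.maxs U \ {a}) := by
          ext x
          exact (hmx x).trans or_comm
        rw [this, Set.ncard_insert_of_notMem (fun h => hbm h.1),
          Set.ncard_sdiff_singleton_add_one (s := E.maxs U) hab.max]
      rw [← hcard]
      refine ih _ (Set.ncard_sdiff_singleton_lt_of_mem hab.max.1) (U \ {a}) ?_ ?_ ?_ ?_ rfl
      · exact fun x hx y hR => ⟨hlow x hx.1 y hR, fun e : y = a => hab.max.2 x hx.1 (e ▸ hR)⟩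
      · exact fun x hx => ⟨hmins hx, fun e : x = a => hx.2 b trivial (e ▸ hab.rel)⟩
      · exact fun e => (e ▸ Set.mem_univ a : a ∈ U \ {a}).2 rfl
      · have hset : (U \ {a}) \ E.maxs (U \ {a}) = (U \ E.maxs U) \ {b} := ?_
        · rwa [double, hset]
        ext x
        have h₁ := hmx x
        simp only [Set.mem_sdiff, Set.mem_singleton_iff, maxs, Set.mem_ofPred_eq, h₁]
        constructor
        · rintro ⟨⟨h₂, h₃⟩, h₄⟩
          push Not at h₄
          exact ⟨⟨h₂, fun h => h₃ (by tauto)⟩, h₄.2⟩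
        · rintro ⟨⟨h₂, h₃⟩, h₄⟩
          exact ⟨⟨h₂, fun e => h₃ (e ▸ hab.max)⟩, by tauto⟩
    -- Since `U` is closed downwards, minimality in `U` is minimality in `E`, so the step would
    -- already exist in `E`.
    · refine absurd ⟨⟨trivial, fun y _ hR => ?_⟩, ⟨⟨trivial, hab.exposed.1.2⟩, fun y hy hR => ?_⟩,
        hab.rel⟩ (hmin a b)
      · exact hab.min.2 y (hlow a hab.min.1 y hR) hR
      · exact hab.exposed.2 y ⟨hlow b hab.exposed.1.1 y hR, hy.2⟩ hR

/-- Deleting one letter `a` of the fold from the irreducible double leaves a reducible monomial.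
Since `a` exposes nothing, this monomial is the double of the heap without `a`, which has exactly
one maximal vertex fewer. -/
theorem ncard_maxs_univ (h : ∀ m : Co C, m.IsIrr → m.DeletesReducibly)
    (hE : E.TwoBetween Set.univ) (hne : ∃ x y, E.R x y)
    (hmax : ∀ a b, ¬ E.ExposesMax Set.univ a b) (hmin : ∀ a b, ¬ E.ExposesMin Set.univ a b)
    (hsub : ∀ S : Set E.carrier, S ≠ Set.univ → E.TwoBetween S → E.StarReducible S) :
    (E.maxs Set.univ).ncard = {x | E.MinIn Set.univ x}.ncard + 1 := by
  obtain ⟨x, y, hxy⟩ := hne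
  -- Choosing `a` with something below it ensures that its removal does not lose a minimal vertex of
  -- `E`.
  obtain ⟨a, ⟨x, hxa⟩, hamax⟩ := (Set.toFinite {a | ∃ x, E.R x a}).exists_maximal ⟨y, x, hxy⟩
  have ha : E.MaxIn Set.univ a := ⟨trivial, fun c _ hR => hR.lt.not_ge (hamax ⟨a, hR⟩ hR.lt.le)⟩
  have hmx : ∀ z, E.MaxIn (Set.univ \ {a}) z ↔ E.MaxIn Set.univ z ∧ z ≠ a := by
    intro z
    refine ⟨fun hz => ⟨⟨trivial, fun y _ hR => ?_⟩, hz.1.2⟩, fun hz => hz.1.sdiff hz.2⟩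
    by_cases hya : y = a
    · exact hmax a z ⟨ha, hz, hya ▸ hR⟩
    · exact hz.2 y ⟨trivial, hya⟩ hR
  have hcard := Set.ncard_sdiff_singleton_add_one (s := E.maxs Set.univ) ha
  have hset : E.maxs (Set.univ \ {a}) = E.maxs Set.univ \ {a} := Set.ext hmx
  rw [← hcard, ← hset]
  congr 1
  refine ncard_maxs_eq hE hmin hsub _ ?_ ?_ ?_ ?_
  · exact fun z _ y hR => ⟨trivial, fun e : y = a => ha.2 z trivial (e ▸ hR)⟩
  · exact fun z hz => ⟨trivial, fun e : z = a => hz.2 x trivial (e ▸ hxa)⟩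
  · exact fun e => (Set.ext_iff.1 e a).2 trivial |>.2 rfl
  · have hW : (Set.univ \ {a}) \ E.maxs (Set.univ \ {a}) = Set.univ \ E.maxs Set.univ := by
      ext z
      simp only [hset, Set.mem_sdiff, Set.mem_univ, Set.mem_singleton_iff, true_and]
      constructor
      · rintro ⟨h₁, h₂⟩ h₃
        exact h₂ ⟨h₃, h₁⟩
      · exact fun h₁ => ⟨fun e => h₁ (e ▸ ha), fun h₂ => h₁ h₂.1⟩
    rw [double, hW]
    refine h _ (double_univ_isIrr hE hmax) _ _ (E.label a) ?_
    rw [double, ha.mon_eq]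

/-- In a minimal counterexample, counting maximal and minimal vertices in the heap and in its
opposite gives each number as the other plus one. -/
theorem starReducible_of_deletesReducibly (h : ∀ m : Co C, m.IsIrr → m.DeletesReducibly)
    (S : Set E.carrier) (hS : E.TwoBetween S) : E.StarReducible S := by
  induction hn : S.ncard using Nat.strong_induction_on generalizing E S with
  | _ n ih =>
    subst hn
    rw [← starReducible_subheap_iff]
    set F := E.subheap S with hF
    have hFS : F.TwoBetween Set.univ := by
      rw [twoBetween_iff, mon_univ, hF, subheap_monomial]
      exact hS.isIrr
    have hcardF : (Set.univ : Set F.carrier).ncard = S.ncard := by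
      rw [Set.ncard_univ]
      rfl
    have hsub : ∀ T : Set F.carrier, T ≠ Set.univ → F.TwoBetween T → F.StarReducible T := by
      intro T hT hT'
      exact ih _ (by rw [← hcardF]; exact Set.ncard_lt_ncard (Set.ssubset_univ_iff.2 hT)) T hT' rfl
    clear_value F
    by_contra hcon
    simp only [StarReducible, not_or, not_exists] at hcon
    obtain ⟨h₁, h₂, h₃⟩ := hcon
    have hne : ∃ x y, F.R x y := by
      by_contra hno
      push Not at hno
      exact h₁ fun x _ y _ => hno x y
    have e₁ := ncard_maxs_univ h hFS hne h₂ h₃ hsub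
    have e₂ := ncard_maxs_univ (E := F.op) h ((op_twoBetween F _).2 hFS)
      (by obtain ⟨x, y, hxy⟩ := hne; exact ⟨y, x, (op_R F y x).2 hxy⟩)
      (fun a b hab => h₃ a b ((op_exposesMax F _ a b).1 hab))
      (fun a b hab => h₂ a b ((op_exposesMin F _ a b).1 hab))
      (fun T hT hT' => op_starReducible F T (hsub T hT ((op_twoBetween F T).1 hT')))
    have e₃ : F.op.maxs Set.univ = {x | F.MinIn Set.univ x} := Set.ext (op_maxIn F Set.univ)
    have e₄ : {x | F.op.MinIn Set.univ x} = F.maxs Set.univ := Set.ext (op_minIn F Set.univ)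
    rw [e₃, e₄] at e₂
    have e₅ : {x | F.MinIn Set.univ x}.ncard = (F.maxs Set.univ).ncard + 1 := e₂
    lia

end LabelledHeap

/-! ### Acyclicity through vectors on the vertices. -/

section SumOn

variable {V : Type*} [Fintype V] {k : Type v} [Field k]

open Classical in
/-- The sum of `d` over the elements of `S` that satisfy `c`. -/
noncomputable def sumOn (S : Set V) (c : V → Prop) (d : V → k) : k :=
  ∑ q, if q ∈ S ∧ c q then d q else 0

theorem sumOn_congr {S : Set V} {c c' : V → Prop} {d d' : V → k} (hc : ∀ q ∈ S, c q ↔ c' q)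
    (hd : ∀ q ∈ S, c q → d q = d' q) : sumOn S c d = sumOn S c' d' := by
  classical
  refine Finset.sum_congr rfl fun q _ => ?_
  by_cases hq : q ∈ S
  · by_cases h : c q
    · simp [hq, h, (hc q hq).1 h, hd q hq h]
    · have h' : ¬ c' q := fun h' => h ((hc q hq).2 h')
      simp [h, h']
  · simp [hq]

open Classical in
theorem sumOn_ite_eq (S : Set V) (c : V → Prop) (x : V) (a : k) :
    sumOn S c (fun q => if q = x then a else 0) = if x ∈ S ∧ c x then a else 0 := by
  rw [sumOn, Finset.sum_eq_single x]
  · simp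
  · intro q _ hq
    simp [hq]
  · simp

theorem sumOn_add (S : Set V) (c : V → Prop) (d e : V → k) :
    sumOn S c (fun q => d q + e q) = sumOn S c d + sumOn S c e := by
  classical
  rw [sumOn, sumOn, sumOn, ← Finset.sum_add_distrib]
  refine Finset.sum_congr rfl fun q _ => ?_
  split_ifs <;> simp

open Classical in
theorem sumOn_erase {S : Set V} {v : V} (hv : v ∈ S) (c : V → Prop) (d : V → k) :
    sumOn S c d = sumOn (S \ {v}) c d + if c v then d v else 0 := by
  have key : ∀ q, (if q ∈ S ∧ c q then d q else 0) = (if q ∈ S \ {v} ∧ c q then d q else 0) +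
      if q = v then (if c v then d v else 0) else 0 := by
    intro q
    by_cases hq : q = v
    · subst hq
      simp [hv]
    · simp [hq]
  rw [sumOn, sumOn, Finset.sum_congr rfl fun q _ => key q, Finset.sum_add_distrib]
  simp

theorem sumOn_erase_of_not {S : Set V} {v : V} {c : V → Prop} (hc : ¬ c v) (d : V → k) :
    sumOn (S \ {v}) c d = sumOn S c d := by
  by_cases hv : v ∈ S
  · rw [sumOn_erase hv, if_neg hc, add_zero]
  · rw [Set.sdiff_singleton_eq_self hv]

theorem sumOn_erase_of_eq_zero {S : Set V} {v : V} (c : V → Prop) {d : V → k} (hd : d v = 0) :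
    sumOn (S \ {v}) c d = sumOn S c d := by
  classical
  by_cases hv : v ∈ S
  · rw [sumOn_erase hv, hd]
    simp
  · rw [Set.sdiff_singleton_eq_self hv]

/-- If every fibre of `f` has sum zero, then so does every union of fibres. -/
theorem sumOn_comp_eq_zero {P : Type*} {S : Set V} {d : V → k} (f : V → P) (c : P → Prop)
    (h : ∀ p, sumOn S (fun q => f q = p) d = 0) : sumOn S (fun q => c (f q)) d = 0 := by
  classical
  rw [sumOn, ← Finset.sum_fiberwise_of_maps_to (t := Finset.univ.image f) (g := f)
    fun q hq => Finset.mem_image_of_mem f hq]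
  refine Finset.sum_eq_zero fun p _ => ?_
  rw [Finset.sum_filter]
  by_cases hp : c p
  · refine (Finset.sum_congr rfl fun q _ => ?_).trans (h p)
    by_cases hq : f q = p <;> simp [hq, hp]
  · refine Finset.sum_eq_zero fun q _ => ?_
    by_cases hq : f q = p <;> simp [hq, hp]

end SumOn

namespace LabelledHeap

variable {P : Type u} {C : Concurrency P} {E : LabelledHeap C} {S : Set E.carrier}
  {k : Type v} [Field k]

/-- `q < w` with distinct concurrent labels. -/
def Low (w q : E.carrier) : Prop := E.R q w ∧ E.label q ≠ E.label w

variable (k E) in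
/-- Acyclicity of the subheap on `S`, in terms of boundary vectors on the vertices: an edge `(x, y)`
corresponds to the vector `x - y`. -/
def AcyclicOn (S : Set E.carrier) : Prop :=
  ∀ d : E.carrier → k, (∀ w ∈ S, sumOn S (Low w) d = 0) →
    (∀ p, sumOn S (fun q => E.label q = p) d = 0) → ∀ q ∈ S, d q = 0

theorem IsPair.not_acyclicOn {x y : E.carrier} (h : IsPair S x y) : ¬ E.AcyclicOn k S := by
  classical
  intro hS
  -- The kernel vector is `x - y`: it is killed by every condition that does not distinguish `x`
  -- from `y`, and no condition defining acyclicity does.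
  have key : ∀ c : E.carrier → Prop, (c x ↔ c y) → sumOn S c
      (fun q => (if q = x then (1 : k) else 0) + if q = y then -1 else 0) = 0 := by
    intro c hc
    rw [sumOn_add, sumOn_ite_eq, sumOn_ite_eq]
    by_cases h' : c x
    · simp [h.left, h.right, h', hc.1 h']
    · have h'' : ¬ c y := fun h'' => h' (hc.2 h'')
      simp [h', h'']
  have := hS _ (fun w hw => key _ ?_) (fun p => key _ (by rw [h.label_eq])) x h.left
  · simp [h.rel.ne] at this
  · constructor
    · rintro ⟨h₁, h₂⟩
      refine ⟨?_, h.label_eq ▸ h₂⟩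
      exact (R_total (fun e => h₂ (by rw [h.label_eq, e])) (h.label_eq ▸ h₁.rel)).resolve_right
        (h.between w hw h₁)
    · rintro ⟨h₁, h₂⟩
      exact ⟨h.rel.trans_of_eq h₁ (.inl h.label_eq), h.label_eq ▸ h₂⟩

theorem IsTrip.low_left_iff {x y z : E.carrier} (h : IsTrip S x y z) {w : E.carrier} (hw : w ∈ S)
    (hwy : w ≠ y) : Low w x ↔ Low w z := by
  constructor
  · rintro ⟨h₁, h₂⟩
    refine ⟨?_, h.label_eq ▸ h₂⟩
    exact (R_total (fun e => h₂ (by rw [h.label_eq, e])) (h.label_eq ▸ h₁.rel)).resolve_right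
      fun h₃ => hwy (h.between w hw h₁ h₃)
  · rintro ⟨h₁, h₂⟩
    exact ⟨h.rel.trans_of_eq h₁ (.inl h.label_eq), h.label_eq ▸ h₂⟩

theorem IsTrip.low_right_iff {x y z : E.carrier} (h : IsTrip S x y z) {q : E.carrier} (hq : q ∈ S)
    (hqy : q ≠ y) : Low z q ↔ Low x q := by
  constructor
  · rintro ⟨h₁, h₂⟩
    refine ⟨?_, h.label_eq ▸ h₂⟩
    exact (R_total (fun e => h₂ (by rw [← h.label_eq, ← e])) (h.label_eq ▸ h₁.rel)).resolve_right
      fun h₃ => hqy (h.between q hq h₃ h₁)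
  · rintro ⟨h₁, h₂⟩
    exact ⟨h₁.trans_of_eq h.rel (.inr (.inl h.label_eq)), h.label_eq ▸ h₂⟩

theorem IsTrip.not_low {x y z : E.carrier} (h : IsTrip S x y z) : ¬ Low x y ∧ ¬ Low y z :=
  ⟨fun h' => h'.1.asymm h.rel_left, fun h' => h'.1.asymm h.rel_right⟩

open Classical in
theorem IsTrip.sumOn_eq {x y z : E.carrier} (h : IsTrip S x y z) {c : E.carrier → Prop}
    (hc : c x ↔ c z) (d : E.carrier → k) (hd : d y = 0) :
    sumOn (S \ {y, z}) c (fun q => d q + if q = x then d z else 0) = sumOn S c d := by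
  have hz : z ∈ S \ {y} := ⟨h.right, h.rel_right.ne.symm⟩
  have hx : x ∈ (S \ {y}) \ {z} := ⟨⟨h.left, h.rel_left.ne⟩, h.rel.ne⟩
  rw [sdiff_pair_eq, sumOn_add, sumOn_ite_eq, ← sumOn_erase_of_eq_zero (S := S) (v := y) c hd,
    sumOn_erase hz]
  by_cases hcz : c z
  · simp only [hx, hc.2 hcz, hcz, and_self, if_true]
  · simp only [hcz, mt hc.1 hcz, and_false, if_false]

/-- The equations at `x` and `z` differ by the term of `y`, so `d y = 0`. Adding `d z` to the entry
at `x` then gives a solution on the contracted set, hence zero, and the equation at `y` separates `d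
x` from `d z`. -/
theorem IsTrip.acyclicOn_of_contract {x y z : E.carrier} (h : IsTrip S x y z)
    (hS : E.AcyclicOn k (S \ {y, z})) : E.AcyclicOn k S := by
  classical
  intro d h₁ h₂
  have hdy : d y = 0 := by
    have e₁ := h₁ z h.right
    have e₂ := h₁ x h.left
    rw [sumOn_erase h.mid, if_pos ⟨h.rel_right, h.label_eq ▸ h.label_ne⟩] at e₁
    rw [← sumOn_erase_of_not h.not_low.1,
      ← sumOn_congr (fun q hq => h.low_right_iff hq.1 hq.2) fun q _ _ => rfl] at e₂
    rwa [e₂, zero_add] at e₁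
  have key := hS (fun q => d q + if q = x then d z else 0) (fun w hw => ?_) fun p => ?_
  · have hq : ∀ q ∈ S, q ≠ x → q ≠ z → d q = 0 := by
      intro q hq hqx hqz
      by_cases hqy : q = y
      · rw [hqy, hdy]
      · simpa [hqx] using key q ⟨hq, by simp [hqy, hqz]⟩
    have hxz : d x + d z = 0 := by
      simpa using key x ⟨h.left, by simp [h.rel_left.ne, h.rel.ne]⟩
    have hx : d x = 0 := by
      have e := h₁ y h.mid
      rw [sumOn_congr (c' := Low y) (d' := fun q => if q = x then d x else 0) (fun _ _ => Iff.rfl),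
        sumOn_ite_eq, if_pos ⟨h.left, h.rel_left, h.label_ne.symm⟩] at e
      · exact e
      · intro q hqS hlow
        by_cases hqx : q = x
        · simp [hqx]
        · rw [if_neg hqx]
          exact hq q hqS hqx fun e => h.not_low.2 (e ▸ hlow)
    have hz : d z = 0 := by rwa [hx, zero_add] at hxz
    intro q hqS
    by_cases hqx : q = x
    · rw [hqx, hx]
    · by_cases hqz : q = z
      · rw [hqz, hz]
      · exact hq q hqS hqx hqz
  · rw [h.sumOn_eq (h.low_left_iff hw.1 fun e => hw.2 (by simp [e])) d hdy]
    exact h₁ w hw.1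
  · rw [h.sumOn_eq (by rw [h.label_eq]) d hdy]
    exact h₂ p

theorem IsTrip.acyclicOn_contract {x y z : E.carrier} (h : IsTrip S x y z)
    (hS : E.AcyclicOn k S) : E.AcyclicOn k (S \ {y, z}) := by
  classical
  intro e h₁ h₂
  -- The entry `e x` is split into `-t` at `x` and `e x + t` at `z`. The value of `t` is forced by
  -- the equation at `y`, which sees `x` but not `z`.
  let t := sumOn ((S \ {y, z}) \ {x}) (Low y) e
  let d : E.carrier → k := fun q => if q = x then -t else if q = y then 0 else
    if q = z then e x + t else e q
  have hxy := h.rel_left.ne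
  have hxz := h.rel.ne
  have hyz := h.rel_right.ne
  have hdx : d x = -t := by simp [d]
  have hdy : d y = 0 := by simp [d, hxy.symm]
  have hdz : d z = e x + t := by simp [d, hxz.symm, hyz.symm]
  have hd : ∀ q, q ≠ x → q ∈ S \ {y, z} → d q = e q := by
    rintro q hqx ⟨-, hq⟩
    simp only [Set.mem_insert_iff, Set.mem_singleton_iff, not_or] at hq
    simp [d, hqx, hq.1, hq.2]
  have hx : x ∈ S \ {y, z} := ⟨h.left, by simp [hxy, hxz]⟩
  have hsum : ∀ c : E.carrier → Prop, (c x ↔ c z) → sumOn S c d = sumOn (S \ {y, z}) c e := by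
    intro c hc
    rw [← h.sumOn_eq hc d hdy]
    refine sumOn_congr (fun _ _ => Iff.rfl) fun q hq _ => ?_
    by_cases hqx : q = x
    · subst hqx
      rw [if_pos rfl, hdx, hdz]
      ring
    · rw [if_neg hqx, add_zero, hd q hqx hq]
  have key := hS d (fun w hw => ?_) fun p => ?_
  · have ht : t = 0 := by simpa [hdx] using key x h.left
    intro q hq
    by_cases hqx : q = x
    · have := key z h.right
      rwa [hdz, ht, add_zero, ← hqx] at this
    · rw [← hd q hqx hq]
      exact key q hq.1
  · have hcase : ∀ w ∈ S, w ≠ y → w ≠ z → sumOn S (Low w) d = 0 := by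
      intro w hw hwy hwz
      rw [hsum _ (h.low_left_iff hw hwy)]
      exact h₁ w ⟨hw, by simp [hwy, hwz]⟩
    by_cases hwy : w = y
    · rw [hwy, ← sumOn_erase_of_not h.not_low.2,
        ← sumOn_erase_of_not (v := y) (fun h' : Low y y => R_irrefl _ h'.1), ← sdiff_pair_eq',
        sumOn_erase hx, if_pos ⟨h.rel_left, h.label_ne.symm⟩, hdx, ← sub_eq_add_neg, sub_eq_zero]
      exact sumOn_congr (fun _ _ => Iff.rfl) fun q hq _ => hd q hq.2 hq.1
    · by_cases hwz : w = z
      · rw [hwz, ← sumOn_erase_of_eq_zero (Low z) hdy,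
          sumOn_congr (fun q hq => h.low_right_iff hq.1 hq.2) fun q _ _ => rfl,
          sumOn_erase_of_eq_zero (Low x) hdy]
        exact hcase x h.left hxy hxz
      · exact hcase w hw hwy hwz
  · rw [hsum _ (by rw [h.label_eq])]
    exact h₂ p

theorem AcyclicOn.of_erase {a : E.carrier} (h : E.AcyclicOn k (S \ {a}))
    (ha : ∀ d : E.carrier → k, (∀ w ∈ S, sumOn S (Low w) d = 0) →
      (∀ p, sumOn S (fun q => E.label q = p) d = 0) → d a = 0) : E.AcyclicOn k S := by
  intro d h₁ h₂ q hq
  have had := ha d h₁ h₂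
  by_cases hqa : q = a
  · rw [hqa, had]
  · refine h d (fun w hw => ?_) (fun p => ?_) q ⟨hq, hqa⟩
    · rw [sumOn_erase_of_eq_zero _ had]
      exact h₁ w hw.1
    · rw [sumOn_erase_of_eq_zero _ had]
      exact h₂ p

/-- Below `b` there is only `a`, so the equation at `b` reads `d a = 0`. -/
theorem ExposesMin.acyclicOn {a b : E.carrier} (hab : E.ExposesMin S a b)
    (hne : E.label a ≠ E.label b) (h : E.AcyclicOn k (S \ {a})) : E.AcyclicOn k S := by
  classical
  refine h.of_erase fun d h₁ _ => ?_
  have e := h₁ b hab.exposed.1.1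
  rw [sumOn_congr (c' := Low b) (d' := fun q => if q = a then d a else 0) (fun _ _ => Iff.rfl),
    sumOn_ite_eq, if_pos ⟨hab.min.1, hab.rel, hne⟩] at e
  · exact e
  · intro q hq hlow
    by_cases hqa : q = a
    · simp [hqa]
    · exact absurd hlow.1 (hab.exposed.2 q ⟨hq, hqa⟩)

/-- The label sums vanish, so the sum over all vertices with labels concurrent with, but different
from, that of `b` is zero. All of these except `a` lie below `b`, and subtracting the equation at
`b` leaves `d a = 0`. -/
theorem ExposesMax.acyclicOn {a b : E.carrier} (hab : E.ExposesMax S a b)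
    (hne : E.label a ≠ E.label b) (h : E.AcyclicOn k (S \ {a})) : E.AcyclicOn k S := by
  classical
  refine h.of_erase fun d h₁ h₂ => ?_
  have e₁ := h₁ b hab.exposed.1.1
  have e₂ := sumOn_comp_eq_zero E.label
    (fun p => C.rel p (E.label b) ∧ p ≠ E.label b) h₂
  rw [sumOn_erase hab.max.1, if_pos ⟨C.symm _ _ hab.rel.rel, hne⟩] at e₂
  rw [sumOn_erase hab.max.1, if_neg fun h' => h'.1.asymm hab.rel, add_zero] at e₁
  rw [← sumOn_congr (fun q hq => ?_) fun q _ _ => rfl, e₁, zero_add] at e₂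
  · exact e₂
  · constructor
    · exact fun hlow => ⟨hlow.1.rel, hlow.2⟩
    · rintro ⟨hC, hlab⟩
      refine ⟨?_, hlab⟩
      refine (R_total (fun e => hlab (by rw [e])) hC).resolve_right fun hR => ?_
      exact hab.exposed.2 q hq hR

theorem acyclicOn_of_trivial (h : ∀ x ∈ S, ∀ y ∈ S, ¬ E.R x y) : E.AcyclicOn k S := by
  classical
  intro d _ h₂ q hq
  have e := h₂ (E.label q)
  rw [sumOn_congr (c' := fun p => E.label p = E.label q) (d' := fun p => if p = q then d q else 0)
    (fun _ _ => Iff.rfl), sumOn_ite_eq, if_pos ⟨hq, rfl⟩] at e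
  · exact e
  · intro p hp hl
    by_cases hpq : p = q
    · simp [hpq]
    · rcases R_total hpq (hl ▸ C.refl _) with hR | hR
      exacts [absurd hR (h p hp q hq), absurd hR (h q hq p hp)]

theorem acyclicOn_of_isIrr (h : ∀ E : LabelledHeap C, E.HasP2 → E.StarReducible Set.univ)
    (hS : (E.mon S).IsIrr) : E.AcyclicOn k S := by
  induction hn : S.ncard using Nat.strong_induction_on generalizing S with
  | _ n ih =>
    subst hn
    rcases starReducible_of_forall h hS with ht | ⟨a, b, hab⟩ | ⟨a, b, hab⟩
    · exact acyclicOn_of_trivial ht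
    · refine hab.acyclicOn (hab.label_ne hS)
        (ih _ (Set.ncard_sdiff_singleton_lt_of_mem hab.max.1) ?_ rfl)
      rw [hab.max.mon_eq] at hS
      exact hS.of_mul_right
    · refine hab.acyclicOn (hab.label_ne hS)
        (ih _ (Set.ncard_sdiff_singleton_lt_of_mem hab.min.1) ?_ rfl)
      rw [hab.min.mon_eq] at hS
      exact hS.of_mul_left

theorem acyclicOn_of_reducible (h : ∀ E : LabelledHeap C, E.HasP2 → E.StarReducible Set.univ)
    (hS : (E.mon S).Reducible) : E.AcyclicOn k S := by
  generalize hm : E.mon S = m at hS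
  induction hS generalizing S with
  | irr hm' => exact acyclicOn_of_isIrr h (hm ▸ hm')
  | step X s t Y hne hC _ ih =>
    obtain ⟨x, y, z, ht, e⟩ := exists_isTrip_of_mon_eq hne hC hm
    exact ht.acyclicOn_of_contract (ih e)

/-- Contractions preserve acyclicity and acyclicity excludes pairs, so contracting until no triple
is left ends in an irreducible monomial. Condition (i) plays no part here. -/
theorem AcyclicOn.reducible (h : E.AcyclicOn k S) : (E.mon S).Reducible := by
  induction hn : S.ncard using Nat.strong_induction_on generalizing S with
  | _ n ih =>
    subst hn
    by_cases hS : (E.mon S).IsIrr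
    · exact .irr hS
    simp only [isIrr_mon_iff, not_and_or, not_forall, not_not] at hS
    rcases hS with ⟨x, y, hp⟩ | ⟨x, y, z, ht⟩
    · exact absurd h hp.not_acyclicOn
    · refine ht.reducible (ih _ (Set.ncard_lt_ncard ?_) (ht.acyclicOn_contract h) rfl)
      exact ⟨Set.sdiff_subset, fun hsub => (hsub ht.mid).2 (by simp)⟩

end LabelledHeap

/-! ### Edges, the boundary map and vertex vectors. -/

namespace LabelledHeap

variable {P : Type u} {C : Concurrency P} {E : LabelledHeap C} {S : Set E.carrier}
  {k : Type v} [Field k]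

instance : Finite E.Edge := Subtype.finite

noncomputable instance : Fintype E.Edge := Fintype.ofFinite _

theorem Edge.R (e : E.Edge) : E.R e.1.1 e.1.2 := R_of_lt_of_eq e.2.1 e.2.2.1

theorem Edge.ext_left {e f : E.Edge} (h : e.1.1 = f.1.1) : e = f := by
  obtain ⟨⟨x, y⟩, h₁, h₂, h₃⟩ := e
  obtain ⟨⟨x', y'⟩, h₁', h₂', h₃'⟩ := f
  obtain rfl : x = x' := h
  simp only at h₁ h₂ h₃ h₁' h₂' h₃'
  suffices y = y' by subst this; rfl
  by_contra hne
  rcases R_total hne (h₂.symm.trans h₂' ▸ C.refl _) with hR | hR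
  · exact h₃' ⟨y, h₂.symm, h₁, hR.lt⟩
  · exact h₃ ⟨y', h₂'.symm, h₁', hR.lt⟩

theorem Edge.ext_right {e f : E.Edge} (h : e.1.2 = f.1.2) : e = f := by
  refine Edge.ext_left ?_
  obtain ⟨⟨x, y⟩, h₁, h₂, h₃⟩ := e
  obtain ⟨⟨x', y'⟩, h₁', h₂', h₃'⟩ := f
  obtain rfl : y = y' := h
  simp only at h₁ h₂ h₃ h₁' h₂' h₃' ⊢
  by_contra hne
  rcases R_total hne (h₂.trans h₂'.symm ▸ C.refl _) with hR | hR
  · exact h₃ ⟨x', h₂'.trans h₂.symm, hR.lt, h₁'⟩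
  · exact h₃' ⟨x, h₂.trans h₂'.symm, hR.lt, h₁⟩

open Classical in
theorem boundary_apply (e : E.Edge →₀ k) (w : E.carrier) :
    E.boundary k e w = ∑ f : E.Edge, e f *
      if f.1.1 < w ∧ w < f.1.2 ∧ C.rel (E.label w) (E.label f.1.1) then 1 else 0 := by
  rw [boundary, Finsupp.linearCombination_apply, Finsupp.sum_fintype _ _ (by simp),
    Finsupp.finsetSum_apply]
  refine Finset.sum_congr rfl fun f _ => ?_
  rw [Finsupp.smul_apply, smul_eq_mul, Finsupp.finsetSum_apply]
  congr 1
  simp [Finsupp.single_apply]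

open Classical in
/-- The vector of vertex coefficients of a combination of edges, `(x, y)` being read as `x - y`. -/
noncomputable def difference (e : E.Edge →₀ k) (q : E.carrier) : k :=
  ∑ f : E.Edge, e f * ((if f.1.1 = q then 1 else 0) - if f.1.2 = q then 1 else 0)

open Classical in
theorem sumOn_difference (e : E.Edge →₀ k) (c : E.carrier → Prop) :
    sumOn Set.univ c (difference e) =
      ∑ f : E.Edge, e f * ((if c f.1.1 then 1 else 0) - if c f.1.2 then 1 else 0) := by
  simp only [sumOn, difference, Set.mem_univ, true_and]
  rw [← Finset.sum_filter, Finset.sum_comm]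
  refine Finset.sum_congr rfl fun f _ => ?_
  rw [← Finset.mul_sum, Finset.sum_sub_distrib]
  simp

/-- For an edge `(x, y)`, the vertices `w` that see `x` below them but not `y` are exactly those
strictly between with concurrent label; an equal label in between is excluded by the definition of
an edge. -/
theorem sumOn_low_difference (e : E.Edge →₀ k) (w : E.carrier) :
    sumOn Set.univ (Low w) (difference e) = E.boundary k e w := by
  classical
  rw [sumOn_difference, boundary_apply]
  refine Finset.sum_congr rfl fun f _ => ?_
  congr 1
  obtain ⟨⟨x, y⟩, h₁, h₂, h₃⟩ := f
  simp only at h₁ h₂ h₃ ⊢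
  have hR : E.R x y := R_of_lt_of_eq h₁ h₂
  have hyx : Low w y → Low w x := fun h =>
    ⟨hR.trans_of_eq h.1 (.inl h₂), fun e => h.2 (h₂.symm.trans e)⟩
  by_cases hy : Low w y
  · have : ¬ (x < w ∧ w < y ∧ C.rel (E.label w) (E.label x)) := fun h => hy.1.lt.asymm h.2.1
    simp [hy, hyx hy, this]
  · by_cases hx : Low w x
    · have hwy : E.R w y := (R_total (fun e => hx.2 (by rw [h₂, e]))
        (h₂ ▸ C.symm _ _ hx.1.rel)).resolve_right fun h => hy ⟨h, h₂ ▸ hx.2⟩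
      simp [hx, hy, hx.1.lt, hwy.lt, C.symm _ _ hx.1.rel]
    · have : ¬ (x < w ∧ w < y ∧ C.rel (E.label w) (E.label x)) := fun h =>
        hx ⟨⟨h.1, C.symm _ _ h.2.2⟩, fun e => h₃ ⟨w, e.symm, h.1, h.2.1⟩⟩
      simp [hx, hy, this]

theorem sumOn_label_difference (e : E.Edge →₀ k) (p : P) :
    sumOn Set.univ (fun q => E.label q = p) (difference e) = 0 := by
  classical
  rw [sumOn_difference]
  refine Finset.sum_eq_zero fun f _ => ?_
  rw [f.2.2.1, sub_self, mul_zero]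

theorem eq_zero_of_difference_eq_zero {e : E.Edge →₀ k} (h : difference e = 0) : e = 0 := by
  classical
  -- Each vertex starts at most one edge and ends at most one. The coefficient at the start of `f`
  -- is `e f` minus that of the edge ending there, which vanishes by induction.
  have key : ∀ x, ∀ f : E.Edge, f.1.1 = x → e f = 0 := by
    intro x
    induction x using WellFoundedLT.induction with
    | _ x ih =>
      rintro f rfl
      have hx := congrFun h f.1.1
      rw [difference, Finset.sum_eq_single f] at hx
      · simpa [f.R.ne.symm] using hx
      · intro g _ hg
        by_cases hg' : g.1.2 = f.1.1
        · rw [ih g.1.1 (hg' ▸ g.R.lt) g rfl, zero_mul]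
        · rw [if_neg (fun h' => hg (Edge.ext_left h')), if_neg hg', sub_self, mul_zero]
      · simp
  ext f
  exact key _ f rfl

theorem exists_edge_left {q z : E.carrier} (h : E.R q z) (hl : E.label q = E.label z) :
    ∃ f : E.Edge, f.1.1 = q := by
  obtain ⟨y, hy, hmin⟩ := (Set.toFinite {y | E.R q y ∧ E.label q = E.label y}).exists_minimal
    ⟨z, h, hl⟩
  refine ⟨⟨(q, y), hy.1.lt, hy.2, ?_⟩, rfl⟩
  rintro ⟨u, hu, h₁, h₂⟩
  exact h₂.not_ge (hmin ⟨R_of_lt_of_eq h₁ hu.symm, hu.symm⟩ h₂.le)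

theorem exists_edge_right {q z : E.carrier} (h : E.R z q) (hl : E.label z = E.label q) :
    ∃ f : E.Edge, f.1.2 = q := by
  obtain ⟨y, hy, hmax⟩ := (Set.toFinite {y | E.R y q ∧ E.label y = E.label q}).exists_maximal
    ⟨z, h, hl⟩
  refine ⟨⟨(y, q), hy.1.lt, hy.2, ?_⟩, rfl⟩
  rintro ⟨u, hu, h₁, h₂⟩
  exact h₁.not_ge (hmax ⟨R_of_lt_of_eq h₂ (hu.trans hy.2), hu.trans hy.2⟩ h₁.le)

/-- Vertices with a common label form a chain. The coefficient of an edge is the partial sum of `d`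
up to its lower end, and differences of successive partial sums recover `d`. -/
theorem exists_difference_eq (d : E.carrier → k)
    (h : ∀ p, sumOn Set.univ (fun q => E.label q = p) d = 0) :
    ∃ e : E.Edge →₀ k, difference e = d := by
  classical
  let s : E.carrier → k := fun q =>
    sumOn Set.univ (fun p => E.label p = E.label q ∧ (p = q ∨ E.R p q)) d
  refine ⟨Finsupp.equivFunOnFinite.symm fun f => s f.1.1, ?_⟩
  ext q
  have h₁ : (∑ f : E.Edge, s f.1.1 * if f.1.1 = q then 1 else 0) = s q := by
    by_cases hq : ∃ z, E.R q z ∧ E.label q = E.label z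
    · obtain ⟨z, hz, hl⟩ := hq
      obtain ⟨f, rfl⟩ := exists_edge_left hz hl
      rw [Finset.sum_eq_single f]
      · simp
      · intro g _ hg
        rw [if_neg fun h' => hg (Edge.ext_left h'), mul_zero]
      · simp
    · push Not at hq
      -- A vertex that starts no edge is the last with its label, where the partial sum is the whole
      -- label sum.
      have hs : s q = 0 := by
        rw [← h (E.label q)]
        refine sumOn_congr (fun p _ => ?_) fun _ _ _ => rfl
        refine ⟨fun h' => h'.1, fun h' => ⟨h', ?_⟩⟩
        by_cases hpq : p = q
        · exact .inl hpq
        · exact .inr ((R_total hpq (h' ▸ C.refl _)).resolve_right fun hR => hq p hR h'.symm)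
      rw [hs]
      refine Finset.sum_eq_zero fun f _ => ?_
      rw [if_neg, mul_zero]
      rintro rfl
      exact hq _ f.R f.2.2.1
  have h₂ : (∑ f : E.Edge, s f.1.1 * if f.1.2 = q then 1 else 0) + d q = s q := by
    have hsq : s q = sumOn Set.univ (fun p => E.label p = E.label q ∧ E.R p q) d + d q := by
      simp only [s]
      rw [sumOn_erase (Set.mem_univ q), if_pos ⟨rfl, .inl rfl⟩,
        ← sumOn_erase_of_not (S := Set.univ) (v := q)
          (c := fun p => E.label p = E.label q ∧ E.R p q) fun h' => R_irrefl _ h'.2]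
      congr 1
      refine sumOn_congr (fun p hp => ?_) fun _ _ _ => rfl
      exact and_congr_right fun _ => ⟨fun h' => h'.resolve_left hp.2, .inr⟩
    rw [hsq]
    congr 1
    by_cases hq : ∃ z, E.R z q ∧ E.label z = E.label q
    · obtain ⟨z, hz, hl⟩ := hq
      obtain ⟨f, rfl⟩ := exists_edge_right hz hl
      rw [Finset.sum_eq_single f]
      · rw [if_pos rfl, mul_one]
        refine sumOn_congr (fun p _ => ?_) fun _ _ _ => rfl
        rw [f.2.2.1]
        refine and_congr_right fun hp => ⟨?_, fun hR => ?_⟩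
        · rintro (rfl | hR)
          · exact f.R
          · exact hR.trans_of_eq f.R (.inl (hp.trans f.2.2.1.symm))
        · by_cases hpf : p = f.1.1
          · exact .inl hpf
          · refine .inr ((R_total hpf (hp.trans f.2.2.1.symm ▸ C.refl _)).resolve_right fun hR' => ?_)
            exact f.2.2.2 ⟨p, hp.trans f.2.2.1.symm, hR'.lt, hR.lt⟩
      · intro g _ hg
        rw [if_neg fun h' => hg (Edge.ext_right h'), mul_zero]
      · simp
    · push Not at hq
      rw [Finset.sum_eq_zero, sumOn, Finset.sum_eq_zero]
      · intro p _
        rw [if_neg]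
        exact fun h' => hq p h'.2.2 h'.2.1
      · intro f _
        rw [if_neg, mul_zero]
        rintro rfl
        exact hq _ f.R f.2.2.1
  simp only [difference, Finsupp.equivFunOnFinite_symm_apply_apply, mul_sub, Finset.sum_sub_distrib]
  rw [h₁, ← h₂]
  ring

theorem isAcyclic_iff : E.IsAcyclic k ↔ E.AcyclicOn k Set.univ := by
  constructor
  · intro h d h₁ h₂ q _
    obtain ⟨e, rfl⟩ := exists_difference_eq d h₂
    have he : e ∈ LinearMap.ker (E.boundary k) := by
      rw [LinearMap.mem_ker]
      ext w
      rw [← sumOn_low_difference, h₁ w trivial]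
      rfl
    rw [h, Submodule.mem_bot] at he
    subst he
    simp [difference]
  · intro h
    refine (Submodule.eq_bot_iff _).2 fun e he => eq_zero_of_difference_eq_zero ?_
    ext q
    refine h _ (fun w _ => ?_) (fun p => sumOn_label_difference e p) q trivial
    rw [sumOn_low_difference, LinearMap.mem_ker.1 he]
    rfl

theorem sumOn_subheap (c : E.carrier → Prop) (d : E.carrier → k) :
    sumOn (V := (E.subheap S).carrier) Set.univ (fun q : S => c q.1) (fun q : S => d q.1) =
      sumOn S c d := by
  classical
  refine Finset.sum_of_injOn (fun q : S => q.1) Subtype.val_injective.injOn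
    (fun _ _ => Finset.mem_coe.2 (Finset.mem_univ _)) ?_ ?_
  · intro q _ hq
    refine if_neg fun h => hq ⟨⟨q, h.1⟩, Finset.mem_coe.2 (Finset.mem_univ _), rfl⟩
  · intro q _
    simp [q.2]

theorem subheap_isAcyclic_iff : (E.subheap S).IsAcyclic k ↔ E.AcyclicOn k S := by
  classical
  rw [isAcyclic_iff]
  have hlow : ∀ (w q : S), @Low P C (E.subheap S) w q ↔ Low w.1 q.1 := fun w q =>
    and_congr (subheap_R q w) Iff.rfl
  constructor
  · intro h d h₁ h₂ q hq
    refine h (fun q : S => d q.1) (fun w _ => ?_) (fun p => ?_) ⟨q, hq⟩ trivial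
    · rw [← h₁ w.1 w.2, ← sumOn_subheap]
      exact sumOn_congr (fun q _ => hlow w q) fun _ _ _ => rfl
    · exact (sumOn_subheap (fun q => E.label q = p) d).trans (h₂ p)
  · intro h d h₁ h₂ q _
    let d' : E.carrier → k := fun q => if hq : q ∈ S then d ⟨q, hq⟩ else 0
    have hd : d = fun q : S => d' q.1 := by
      funext q
      exact (dif_pos q.2 : d' q.1 = d ⟨q.1, q.2⟩).symm
    rw [hd] at h₁ h₂ ⊢
    refine h d' (fun w hw => ?_) (fun p => ?_) q.1 q.2
    · rw [← h₁ ⟨w, hw⟩ trivial, ← sumOn_subheap]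
      exact (sumOn_congr (V := (E.subheap S).carrier) (fun q _ => hlow ⟨w, hw⟩ q)
        fun _ _ _ => rfl).symm
    · exact (sumOn_subheap (fun q => E.label q = p) d').symm.trans (h₂ p)

theorem delete_isAcyclic_iff (v : E.carrier) :
    (E.delete v).IsAcyclic k ↔ E.AcyclicOn k (Set.univ \ {v}) := by
  rw [delete, subheap_isAcyclic_iff, setOf_ne_eq]

/-- A strongly acyclic heap has property P2. -/
theorem IsStronglyAcyclic.hasP2 (h : E.IsStronglyAcyclic k) : E.HasP2 := by
  rw [hasP2_iff, ← mon_univ, isIrr_mon_iff]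
  refine ⟨fun x y hp => hp.not_acyclicOn (isAcyclic_iff.1 h.1), fun x y z ht => ?_⟩
  -- Deleting the middle of a triple leaves its ends as a pair.
  refine IsPair.not_acyclicOn (x := x) (y := z) ?_ ((delete_isAcyclic_iff y).1 (h.2 y))
  exact ⟨⟨trivial, ht.rel_left.ne⟩, ⟨trivial, ht.rel_right.ne.symm⟩, ht.rel, ht.label_eq,
    fun u hu h₁ h₂ => hu.2 (ht.between u trivial h₁ h₂)⟩

theorem exists_toTL_eq_iff (v : E.carrier) :
    (∃ G : LabelledHeap C, G.HasP2 ∧ (E.delete v).toTL = G.toTL) ↔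
      (E.mon (Set.univ \ {v})).Reducible := by
  rw [← delete_monomial, ← TL.ofCo_mem_monomialBasis_iff]
  constructor
  · rintro ⟨G, hG, e⟩
    exact ⟨G.monomial, ⟨G, hG, rfl⟩, e.symm⟩
  · rintro ⟨_, ⟨G, hG, rfl⟩, e⟩
    exact ⟨G, hG, e.symm⟩

theorem forall_deletesReducibly_iff : (∀ m : Co C, m.IsIrr → m.DeletesReducibly) ↔
    ∀ E : LabelledHeap C, E.HasP2 → ∀ v, (E.mon (Set.univ \ {v})).Reducible := by
  constructor
  · intro h E hE v
    exact Co.DeletesReducibly.mon_sdiff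
      (h _ (by rw [mon_univ]; exact hasP2_iff.1 hE)) (Set.mem_univ v)
  · intro h m hm X Y p e
    obtain ⟨E, rfl⟩ := exists_monomial_eq m
    rw [← mon_univ] at e
    obtain ⟨v, -, -, ev⟩ := exists_mem_of_mon_eq e
    exact ev ▸ h E (hasP2_iff.2 hm) v

end LabelledHeap

/-! ### Assembly of the equivalences. -/

theorem Co.forall_deletesReducibly_iff_word {P : Type u} {C : Concurrency P} :
    (∀ m : Co C, m.IsIrr → m.DeletesReducibly) ↔
      ∀ w : List P, (Co.word C w).IsIrr → ∀ i : Fin w.length,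
        (Co.word C (w.eraseIdx i)).Reducible := by
  constructor
  · intro h w hw i
    rw [List.eraseIdx_eq_take_drop_succ, Co.word_append]
    refine h _ hw _ _ (w[i]) ?_
    rw [mul_assoc, ← Co.word_cons, ← Co.word_append]
    simp
  · intro h m hm X Y p e
    obtain ⟨x, rfl⟩ := Co.exists_word X
    obtain ⟨y, rfl⟩ := Co.exists_word Y
    have := h (x ++ p :: y) (by simpa [e, mul_assoc] using hm) ⟨x.length, by simp⟩
    rw [List.eraseIdx_append_of_length_le le_rfl] at this
    simpa using this

theorem theorem1p5p1 {P : Type u} (C : Concurrency P) (k : Type v) [Field k] :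
    List.TFAE [
      ∀ E : LabelledHeap C, E.HasP2 → E.HasP1,
      ∀ E : LabelledHeap C, E.HasP2 → E.IsStronglyAcyclic k,
      ∀ E : LabelledHeap C, E.HasP2 ↔ E.IsStronglyAcyclic k,
      ∀ E : LabelledHeap C, E.HasP2 → ∀ a : E.carrier,
        ∃ G : LabelledHeap C, G.HasP2 ∧ (E.delete a).toTL = G.toTL,
      ∀ w : List P, TL.IsBasisMonomial C (Co.word C w) → ∀ i : Fin w.length,
        TL.ofCo C (Co.word C (w.eraseIdx i)) ∈ TL.monomialBasis C] := by
  -- After this translation the last two conditions are literally the same statement about deleting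
  -- letters of irreducible monomials.
  simp only [LabelledHeap.exists_toTL_eq_iff, TL.ofCo_mem_monomialBasis_iff,
    TL.isBasisMonomial_iff, ← Co.forall_deletesReducibly_iff_word,
    ← LabelledHeap.forall_deletesReducibly_iff, LabelledHeap.forall_hasP1_iff]
  tfae_have 3 → 2 := fun h E => (h E).1
  tfae_have 2 → 3 := fun h E => ⟨h E, fun h' => h'.hasP2⟩
  tfae_have 4 ↔ 5 := Iff.rfl
  tfae_have 2 → 4 := fun h => LabelledHeap.forall_deletesReducibly_iff.2 fun E hE v =>
    ((LabelledHeap.delete_isAcyclic_iff v).1 ((h E hE).2 v)).reducible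
  tfae_have 4 → 1 := fun h E hE => LabelledHeap.starReducible_of_deletesReducibly h _
    (LabelledHeap.hasP2_iff_twoBetween.1 hE)
  tfae_have 1 → 2 := fun h E hE => by
    refine ⟨LabelledHeap.isAcyclic_iff.2 (LabelledHeap.acyclicOn_of_isIrr h ?_), fun v =>
      (LabelledHeap.delete_isAcyclic_iff v).2 (LabelledHeap.acyclicOn_of_reducible h ?_)⟩
    · rw [LabelledHeap.mon_univ]
      exact LabelledHeap.hasP2_iff.1 hE
    · exact LabelledHeap.forall_deletesReducibly_iff.1 (fun m hm => hm.deletesReducibly h) E hE v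
  tfae_finish
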